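/- Fields are not assumed commutative. A field extension $K/k$ has Galois group $\mathrm{Gal}(K/k)$, the group of automorphisms of $K$ fixing $k$ pointwise; it is Galois if $k$ is the set of elements of $K$ fixed by $\mathrm{Gal}(K/k)$, and outer if the only inner automorphism of $K$ that is the identity on $k$ is the identity of $K$. A field $H$ satisfies $\mathrm{IGP}_H$ if every finite group is isomorphic to the Galois group of some outer Galois extension of $H$. A commutative field $\mathbf{k}$ satisfies $\mathrm{SIGP}_{\mathbf{k}}$ if for every finite group $G$ there is a field $L$ with $\mathbf{k}(t)\subset L\subset \mathbf{k}((t))$ such that $L/\mathbf{k}(t)$ is Galois with group isomorphic to $G$. For a field $R$ with an automorphism $\sigma$, $R(t,\sigma)$ denotes the field of fractions of the twisted polynomial ring $R[t,\sigma]$, in which $ta=\sigma(a)t$ for $a\in R$. **Theorem 6.** Let $h/k$ be a field extension and $(h_n)_{n\in\mathbb{N}}$ an increasing sequence of subfields of $h$ containing $k$, with $h=\bigcup_n h_n$, such that for every $n$ the extension $h_n/k$ is outer Galois of finite degree $d_n$ and $\mathrm{Gal}(h_n/k)$ is cyclic, generated by an element $\sigma_n$, with $\sigma_n|_{h_m}=\sigma_m$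 for all $m\le n$. Suppose that $d_{n+1}/d_n$ and $d_n$ are coprime for all $n$. Let $\mathbf{k}$ be a commutative field contained in the center $Z(k)$. Consider sequences $(a_n)_{n\in\mathbb{N}}$ of natural numbers and $(l_n)_{n\in\mathbb{N}}$ of positive integers such that, for all $n$, $$l_n \mid l_{n+1},\qquad d_n \;\Big|\; \frac{a_{n+1}\,l_{n+1}}{l_n}-a_n,\qquad d_n\mid l_n a_n. \tag{$*$}$$ Then there is a sequence $(l_n)$ which satisfies $(*)$ together with the constant sequence $a_n=1$. Moreover, for any sequence $(l_n)$ that satisfies $(*)$ together with $a_n=1$, the maps $h_n(t,\sigma_n)\to h_{n+1}(t,\sigma_{n+1})$, $P(t)\mapsto P(t^{l_{n+1}/l_n})$, are well-defined field homomorphisms, and for their direct limit $H:=\varinjlim h_n(t,\sigma_n)$ one has $$\mathrm{SIGP}_{\mathbf{k}}\ \Longrightarrow\ \mathrm{IGP}_H.$$ -/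

import Mathlib

universe u

namespace TwistedTower

open scoped nonZeroDivisors

/-! ### Extensions of skew fields

A field is a not necessarily commutative division ring. An extension `K / k` is given by a
homomorphism `f : k →+* K`. -/

section Extension

variable {k K : Type u} [DivisionRing k] [DivisionRing K] (f : k →+* K)

/-- The Galois group of `K / k`: the automorphisms of `K` which fix `k` pointwise. -/
def Gal : Subgroup (RingAut K) where
  carrier := {s | ∀ x, s (f x) = f x}
  mul_mem' {s s'} hs hs' x := by
    change s (s' (f x)) = f x
    rw [hs' x, hs x]
  one_mem' _ := rfl
  inv_mem' {s} hs x := by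
    change s.symm (f x) = f x
    rw [RingEquiv.symm_apply_eq]
    exact (hs x).symm

/-- `K / k` is Galois: the elements of `K` fixed by the Galois group are those of `k`. -/
def IsGaloisExt : Prop :=
  ∀ y : K, (∀ s ∈ Gal f, s y = y) → y ∈ Set.range f

/-- `K / k` is outer: the only inner automorphism of `K` which restricts to the identity on `k` is
the identity. -/
def IsOuterExt : Prop :=
  ∀ c : K, c ≠ 0 → (∀ x : k, c * f x * c⁻¹ = f x) → ∀ y : K, c * y * c⁻¹ = y

/-- `K / k` is of finite degree `d`: the dimension of `K` as a left `k`-vector space is `d`. -/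
def HasDegree (d : ℕ) : Prop :=
  letI : Module k K := Module.compHom K f
  Module.rank k K = d

end Extension

/-- The inverse Galois property of a skew field `H`: every finite group is the Galois group of an
outer Galois extension of `H`. -/
def IGP (H : Type u) [DivisionRing H] : Prop :=
  ∀ (G : Type) [Group G] [Finite G], ∃ (K : Type u) (_ : DivisionRing K) (f : H →+* K),
    IsGaloisExt f ∧ IsOuterExt f ∧ Nonempty (Gal f ≃* G)

/-- The inclusion `F(t) ⊆ F((t))`, by expansion of rational functions at `0`. -/
noncomputable instance ratFuncAlgebraLaurentSeries (F : Type u) [Field F] :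
    Algebra (RatFunc F) (LaurentSeries F) :=
  RatFunc.liftAlgebra F (LaurentSeries F)

/-- The property `SIGP` of a commutative field `F`: every finite group is the Galois group of a
Galois extension `L / F(t)` with `F(t) ⊆ L ⊆ F((t))`. -/
def SIGP (F : Type u) [Field F] : Prop :=
  ∀ (G : Type) [Group G] [Finite G], ∃ L : IntermediateField (RatFunc F) (LaurentSeries F),
    IsGalois (RatFunc F) L ∧ Nonempty ((L ≃ₐ[RatFunc F] L) ≃* G)

/-! ### Skew polynomial rings over a division ring satisfy the Ore condition -/

section Poly

open SkewPolynomial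

variable {R : Type*} [DivisionRing R] [MulSemiringAction (Multiplicative ℕ) R]

lemma iter_eq_zero {n : ℕ} {a : R} : (φ^[n] a) = 0 ↔ a = 0 := by
  rw [φ_iterate_apply]
  exact map_eq_zero (MulSemiringAction.toRingHom (Multiplicative ℕ) R (Multiplicative.ofAdd n))

lemma coeff_mul' (p q : SkewPolynomial R) (n : ℕ) :
    (p * q).coeff n = ∑ i ∈ p.support, ∑ j ∈ q.support,
      if i + j = n then p.coeff i * φ^[i] (q.coeff j) else 0 := by
  rw [mul_def, sum_def]
  have key : ∀ (s : Finset ℕ) (F : ℕ → SkewPolynomial R),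
      (∑ i ∈ s, F i).coeff n = ∑ i ∈ s, (F i).coeff n := fun s F =>
    map_sum (⟨⟨fun r : SkewPolynomial R => r.coeff n, coeff_zero n⟩,
      fun a b => coeff_add a b n⟩ : SkewPolynomial R →+ R) F s
  rw [key]
  refine Finset.sum_congr rfl fun i _ => ?_
  rw [sum_def, key]
  exact Finset.sum_congr rfl fun j _ => coeff_monomial

lemma coeff_monomial_mul' (k i : ℕ) (a : R) (q : SkewPolynomial R) :
    (monomial k a * q).coeff (k + i) = a * φ^[k] (q.coeff i) := by
  by_cases ha : a = 0
  · subst ha; simp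
  rw [coeff_mul', support_monomial k ha, Finset.sum_singleton, Finset.sum_eq_single i]
  · simp [coeff_monomial]
  · intro j _ hj
    rw [if_neg (by omega)]
  · intro hi
    rw [notMem_support_iff.mp hi]
    simp

instance : NoZeroDivisors (SkewPolynomial R) where
  eq_zero_or_eq_zero_of_mul_eq_zero {p q} h := by
    by_contra hne
    push Not at hne
    obtain ⟨hp, hq⟩ := hne
    have hp' : p.support.Nonempty := Finset.nonempty_iff_ne_empty.mpr (by simpa using hp)
    have hq' : q.support.Nonempty := Finset.nonempty_iff_ne_empty.mpr (by simpa using hq)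
    set m := p.support.max' hp'
    set n := q.support.max' hq'
    have hm : m ∈ p.support := Finset.max'_mem _ _
    have hn : n ∈ q.support := Finset.max'_mem _ _
    have hc : (p * q).coeff (m + n) = p.coeff m * φ^[m] (q.coeff n) := by
      rw [coeff_mul', Finset.sum_eq_single m, Finset.sum_eq_single n]
      · simp
      · intro j _ hj
        rw [if_neg (by omega)]
      · exact fun h => absurd hn h
      · intro i hi him
        refine Finset.sum_eq_zero fun j hj => if_neg ?_
        have h1 := Finset.le_max' _ _ hi
        have h2 := Finset.le_max' _ _ hj
        change i ≤ m at h1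
        change j ≤ n at h2
        omega
      · exact fun h => absurd hm h
    rw [h, coeff_zero] at hc
    rcases mul_eq_zero.mp hc.symm with h1 | h1
    · exact mem_support_iff.mp hm h1
    · exact mem_support_iff.mp hn (iter_eq_zero.mp h1)

/-- Left division with remainder: every left ideal is principal. -/
instance : IsNoetherianRing (SkewPolynomial R) := by
  classical
  refine ⟨fun I => ?_⟩
  let P : ℕ → Prop := fun m =>
    ∃ g ∈ I, g.coeff m ≠ 0 ∧ ∀ i, m < i → g.coeff i = 0
  by_cases hP : ∃ m, P m
  · obtain ⟨g, hgI, hg0, hg⟩ := Nat.find_spec hP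
    set m := Nat.find hP
    refine ⟨{g}, le_antisymm (Submodule.span_le.mpr (by simpa using hgI)) ?_⟩
    have key : ∀ n (f : SkewPolynomial R), f ∈ I → (∀ i, n ≤ i → f.coeff i = 0) →
        f ∈ Submodule.span (SkewPolynomial R) (({g} : Finset (SkewPolynomial R)) : Set _) := by
      intro n
      induction n with
      | zero =>
        intro f _ hf
        have : f = 0 := by
          ext i
          exact hf i (Nat.zero_le i)
        rw [this]
        exact Submodule.zero_mem _
      | succ n ih =>
        intro f hfI hf
        by_cases h0 : f.coeff n = 0
        · refine ih f hfI fun i hi => ?_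
          rcases hi.eq_or_lt with rfl | hi
          · exact h0
          · exact hf i hi
        · have hmn : m ≤ n := Nat.find_min' hP ⟨f, hfI, h0, fun i hi => hf i hi⟩
          obtain ⟨k, rfl⟩ := Nat.exists_eq_add_of_le' hmn
          set q : SkewPolynomial R :=
            monomial k (f.coeff (k + m) * (φ^[k] (g.coeff m))⁻¹) with hq
          have hqg : q * g ∈ Submodule.span (SkewPolynomial R)
              (({g} : Finset (SkewPolynomial R)) : Set _) :=
            Submodule.smul_mem _ q (Submodule.subset_span (by simp))
          have hr := ih (f - q * g) (I.sub_mem hfI (I.smul_mem q hgI)) fun i hi => by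
            obtain ⟨j, rfl⟩ := Nat.exists_eq_add_of_le (show k ≤ i by omega)
            rw [coeff_sub, hq, coeff_monomial_mul']
            rcases (show m ≤ j by omega).eq_or_lt with rfl | hj
            · rw [inv_mul_cancel_right₀ (iter_eq_zero.not.mpr hg0), sub_self]
            · rw [hf _ (by omega), hg j hj, iter_eq_zero.mpr rfl, mul_zero, sub_self]
          simpa using Submodule.add_mem _ hr hqg
    intro f hf
    refine key (f.support.sup id + 1) f hf fun i hi => ?_
    by_contra hne
    have := Finset.le_sup (f := id) (mem_support_iff.mpr hne)
    simp only [id] at this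
    omega
  · refine ⟨∅, ?_⟩
    rw [Finset.coe_empty, Submodule.span_empty, eq_comm, Submodule.eq_bot_iff]
    intro f hf
    by_contra hne
    have hs : f.support.Nonempty := Finset.nonempty_iff_ne_empty.mpr (by simpa using hne)
    refine hP ⟨f.support.max' hs, f, hf, mem_support_iff.mp (Finset.max'_mem _ _), fun i hi => ?_⟩
    by_contra h
    exact absurd (Finset.le_max' _ _ (mem_support_iff.mpr h)) (not_le.mpr hi)

/-- The Ore condition. -/
noncomputable instance : OreLocalization.OreSet (SkewPolynomial R)⁰ :=
  haveI : IsDomain (SkewPolynomial R) := NoZeroDivisors.to_isDomain _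
  Classical.choice nonempty_oreSet_of_strongRankCondition

end Poly

/-! ### Skew fraction fields -/

/-- The ring `R`, carrying the action of `ℕ` through the powers of the automorphism `σ`. -/
def Twist (R : Type u) [DivisionRing R] (_σ : R ≃+* R) : Type u := R

namespace Twist

variable {R : Type u} [DivisionRing R] (σ : R ≃+* R)

instance : DivisionRing (Twist R σ) := inferInstanceAs (DivisionRing R)

/-- `n` acts on `Twist R σ` as `σ ^ n`. -/
instance : MulSemiringAction (Multiplicative ℕ) (Twist R σ) :=
  letI : MulSemiringAction (RingAut R) (Twist R σ) :=
    inferInstanceAs (MulSemiringAction (RingAut R) R)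
  MulSemiringAction.compHom (Twist R σ) (powersHom (RingAut R) σ)

/-- The identity map `R → Twist R σ`. -/
def of : R ≃+* Twist R σ := RingEquiv.refl R

lemma smul_of (n : ℕ) (x : R) : Multiplicative.ofAdd n • of σ x = of σ ((σ ^ n : RingAut R) x) := rfl

end Twist

/-- The twisted polynomial ring `R[t, σ]`, with left coefficients and `t a = σ(a) t`. -/
abbrev TwistedPoly (R : Type u) [DivisionRing R] (σ : R ≃+* R) : Type u :=
  SkewPolynomial (Twist R σ)

/-- The skew fraction field `R(t, σ)`: the (Ore) field of fractions of `R[t, σ]`. -/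
abbrev TwistedFrac (R : Type u) [DivisionRing R] (σ : R ≃+* R) : Type u :=
  OreLocalization (TwistedPoly R σ)⁰ (TwistedPoly R σ)

namespace TwistedFrac

section

variable {R : Type u} [DivisionRing R] (σ : R ≃+* R)

/-- The embedding `R[t, σ] → R(t, σ)`. -/
noncomputable def num : TwistedPoly R σ →+* TwistedFrac R σ :=
  OreLocalization.numeratorRingHom

/-- The embedding of the coefficients in `R(t, σ)`. -/
noncomputable def const : R →+* TwistedFrac R σ :=
  (num σ).comp (SkewPolynomial.CRingHom.comp (Twist.of σ).toRingHom)

/-- The indeterminate `t` of `R(t, σ)`. -/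
noncomputable def t : TwistedFrac R σ :=
  num σ SkewPolynomial.X

/-- The defining relation `t a = σ(a) t`. -/
lemma t_mul_const (x : R) : t σ * const σ x = const σ (σ x) * t σ := by
  simp only [t, const, RingHom.comp_apply, ← map_mul]
  congr 1
  simp [SkewPolynomial.CRingHom_eq_C, ← SkewPolynomial.monomial_zero_left]
  rfl

end

section map

variable {R S : Type u} [DivisionRing R] [DivisionRing S] {σ : R ≃+* R} {τ : S ≃+* S}

lemma apply_pow (j : R →+* S) (m : ℕ) (hj : ∀ x, j (σ x) = (τ ^ m : RingAut S) (j x))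
    (n : ℕ) (x : R) : j ((σ ^ n : RingAut R) x) = (τ ^ (m * n) : RingAut S) (j x) := by
  induction n generalizing x with
  | zero => rfl
  | succ n ih =>
    rw [pow_succ, RingAut.mul_apply, ih, hj, ← RingAut.mul_apply, ← pow_add, Nat.mul_succ]

lemma monomial_mul (m n : ℕ) (x y : S) :
    (SkewPolynomial.monomial m (Twist.of τ x) * SkewPolynomial.monomial n (Twist.of τ y) :
      TwistedPoly S τ) =
    SkewPolynomial.monomial (m + n) (Twist.of τ (x * (τ ^ m : RingAut S) y)) := by
  rw [SkewPolynomial.monomial_mul_monomial, SkewPolynomial.φ_iterate_apply, Twist.smul_of, map_mul (Twist.of τ)]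

/-- If `j ∘ σ = τ ^ m ∘ j`, the homomorphism `R[t, σ] → S[t, τ]`, `P(t) ↦ P(t ^ m)`, where `j` is
applied to the coefficients. -/
noncomputable def polyMap (j : R →+* S) (m : ℕ) (hj : ∀ x, j (σ x) = (τ ^ m : RingAut S) (j x)) :
    TwistedPoly R σ →+* TwistedPoly S τ :=
  SkewMonoidAlgebra.liftNCRingHom
    (SkewPolynomial.CRingHom.comp
      ((Twist.of τ).toRingHom.comp (j.comp (Twist.of σ).symm.toRingHom)))
    (powersHom (TwistedPoly S τ) (SkewPolynomial.X ^ m))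
    (by
      intro x y
      change SkewPolynomial.monomial 0 (Twist.of τ (j ((σ ^ (Multiplicative.toAdd y) : RingAut R) x)))
          * (SkewPolynomial.X ^ m) ^ (Multiplicative.toAdd y) =
        (SkewPolynomial.X ^ m) ^ (Multiplicative.toAdd y)
          * SkewPolynomial.monomial 0 (Twist.of τ (j x))
      rw [← pow_mul, SkewPolynomial.X_pow_eq_monomial, ← map_one (Twist.of τ), monomial_mul,
        monomial_mul]
      have := apply_pow j m hj (Multiplicative.toAdd y) x
      rw [zero_add, add_zero, one_mul, map_one, mul_one]
      exact congrArg (fun z => SkewPolynomial.monomial _ (Twist.of τ z)) this)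

/-- On monomials, `a t ^ n ↦ j(a) t ^ (m n)`. -/
lemma polyMap_monomial (j : R →+* S) (m : ℕ) (hj : ∀ x, j (σ x) = (τ ^ m : RingAut S) (j x))
    (n : ℕ) (x : R) :
    polyMap j m hj (SkewPolynomial.monomial n (Twist.of σ x)) =
      SkewPolynomial.monomial (m * n) (Twist.of τ (j x)) := by
  refine (SkewMonoidAlgebra.liftNC_single _ _ _ _).trans ?_
  change SkewPolynomial.monomial 0 (Twist.of τ (j x)) * (SkewPolynomial.X ^ m) ^ n = _
  rw [← pow_mul, SkewPolynomial.monomial_mul_X_pow, zero_add]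

lemma coeff_polyMap (j : R →+* S) (m : ℕ) (hm : 0 < m)
    (hj : ∀ x, j (σ x) = (τ ^ m : RingAut S) (j x)) (p : TwistedPoly R σ) (n : ℕ) :
    (polyMap j m hj p).coeff (m * n) = Twist.of τ (j ((Twist.of σ).symm (p.coeff n))) := by
  induction p using SkewPolynomial.induction with
  | h0 => simp
  | ha k r q _ _ ih =>
    rw [map_add, SkewPolynomial.coeff_add, SkewPolynomial.coeff_add, ih, map_add, map_add, map_add,
      ← (Twist.of σ).apply_symm_apply r, polyMap_monomial, SkewPolynomial.coeff_monomial,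
      SkewPolynomial.coeff_monomial]
    by_cases h : k = n <;> simp [h, hm.ne']

lemma polyMap_injective (j : R →+* S) (m : ℕ) (hm : 0 < m)
    (hj : ∀ x, j (σ x) = (τ ^ m : RingAut S) (j x)) : Function.Injective (polyMap j m hj) := by
  refine (injective_iff_map_eq_zero _).mpr fun p hp => ?_
  ext n
  have h := coeff_polyMap j m hm hj p n
  rw [hp, SkewPolynomial.coeff_zero] at h
  have h2 := (map_eq_zero_iff _ (Twist.of τ).injective).mp h.symm
  have h3 := (map_eq_zero_iff _ j.injective).mp h2
  exact (map_eq_zero_iff _ (Twist.of σ).symm.injective).mp h3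

lemma num_injective : Function.Injective (num σ) :=
  OreLocalization.numeratorHom_inj fun _ hx => hx.1

/-- The embedding `R(t, σ) → S(t, τ)`, `P(t) ↦ P(t ^ m)`, extending `polyMap`. -/
noncomputable def map (j : R →+* S) (m : ℕ) (hm : 0 < m)
    (hj : ∀ x, j (σ x) = (τ ^ m : RingAut S) (j x)) : TwistedFrac R σ →+* TwistedFrac S τ :=
  OreLocalization.universalHom ((num τ).comp (polyMap j m hj))
    (IsUnit.liftRight
      (((num τ).comp (polyMap j m hj)).toMonoidHom.comp
        (TwistedPoly R σ)⁰.subtype)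
      fun s => isUnit_iff_ne_zero.mpr <|
        (map_ne_zero_iff _ num_injective).mpr <|
          (map_ne_zero_iff _ (polyMap_injective j m hm hj)).mpr (nonZeroDivisors.ne_zero s.2))
    fun _ => rfl

lemma map_num (j : R →+* S) (m : ℕ) (hm : 0 < m)
    (hj : ∀ x, j (σ x) = (τ ^ m : RingAut S) (j x)) (p : TwistedPoly R σ) :
    map j m hm hj (num σ p) =
      num τ (polyMap j m hj p) :=
  OreLocalization.universalHom_commutes ((num τ).comp (polyMap j m hj)) _ (fun _ => rfl)

/-- Two homomorphisms out of `R(t, σ)` which agree on monomials are equal. -/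
lemma hom_ext {K : Type u} [DivisionRing K] {f g : TwistedFrac R σ →+* K}
    (h : ∀ n x, f (num σ (SkewPolynomial.monomial n (Twist.of σ x))) =
      g (num σ (SkewPolynomial.monomial n (Twist.of σ x)))) :
    f = g := by
  have h1 : ∀ p : TwistedPoly R σ, f (num σ p) =
      g (num σ p) := by
    intro p
    induction p using SkewPolynomial.induction with
    | h0 => simp
    | ha k r q _ _ ih => rw [map_add, map_add, map_add, ih, ← (Twist.of σ).apply_symm_apply r, h]
  ext z
  induction z using OreLocalization.ind with
  | _ r s =>
    have hs : num σ (s : TwistedPoly R σ) *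
        (r /ₒ s : TwistedFrac R σ) = num σ r :=
      OreLocalization.mul_cancel
    have h0 : f (num σ (s : TwistedPoly R σ)) ≠ 0 :=
      (map_ne_zero f).mpr ((map_ne_zero_iff _ num_injective).mpr (nonZeroDivisors.ne_zero s.2))
    refine mul_left_cancel₀ h0 ?_
    rw [← map_mul, hs, h1, h1, ← map_mul, hs]

end map

end TwistedFrac

/-! ### Towers -/

section Tower

variable {h : Type u} [DivisionRing h] (E : ℕ → Subfield h) (τ : ∀ n, E n ≃+* E n) (l : ℕ → ℕ)

/-- The conditions under which `P(t) ↦ P(t ^ (l (n+1) / l n))` is a well-defined homomorphism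
`E n (t, τ n) → E (n+1) (t, τ (n+1))` for every `n`. The last one says that
`t ^ (l (n+1) / l n) * x = τ n (x) * t ^ (l (n+1) / l n)` in `E (n+1) (t, τ (n+1))` for `x` in
`E n`. -/
structure TransitionsDefined : Prop where
  mono : ∀ n, E n ≤ E (n + 1)
  pos : ∀ n, 0 < l n
  dvd : ∀ n, l n ∣ l (n + 1)
  comm : ∀ n (x : E n), Subfield.inclusion (mono n) (τ n x) =
    (τ (n + 1) ^ (l (n + 1) / l n) : RingAut (E (n + 1))) (Subfield.inclusion (mono n) x)

variable {E τ l}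

namespace TransitionsDefined

lemma le (H : TransitionsDefined E τ l) {i j : ℕ} (hij : i ≤ j) : E i ≤ E j := monotone_nat_of_le_succ H.mono hij

lemma dvd' (H : TransitionsDefined E τ l) {i j : ℕ} (hij : i ≤ j) : l i ∣ l j := by
  induction j, hij using Nat.le_induction with
  | base => exact dvd_rfl
  | succ j _ ih => exact ih.trans (H.dvd j)

lemma div_pos' (H : TransitionsDefined E τ l) {i j : ℕ} (hij : i ≤ j) : 0 < l j / l i :=
  Nat.div_pos (Nat.le_of_dvd (H.pos j) (H.dvd' hij)) (H.pos i)

lemma div_mul_div (H : TransitionsDefined E τ l) {i j k : ℕ} (hij : i ≤ j) (hjk : j ≤ k) :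
    l k / l j * (l j / l i) = l k / l i := by
  have hi := H.pos i
  have hj := H.pos j
  obtain ⟨a, ha⟩ := H.dvd' hij
  obtain ⟨b, hb⟩ := H.dvd' hjk
  rw [hb, Nat.mul_div_cancel_left _ hj, ha, mul_assoc, Nat.mul_div_cancel_left _ hi,
    Nat.mul_div_cancel_left _ hi, mul_comm]

lemma comm' (H : TransitionsDefined E τ l) {i j : ℕ} (hij : i ≤ j) (x : E i) : Subfield.inclusion (H.le hij) (τ i x) =
    (τ j ^ (l j / l i) : RingAut (E j)) (Subfield.inclusion (H.le hij) x) := by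
  induction j, hij using Nat.le_induction with
  | base =>
    rw [Nat.div_self (H.pos i), pow_one]
    rfl
  | succ j hij ih =>
    have h1 := congrArg (Subfield.inclusion (H.mono j)) ih
    have h2 := TwistedFrac.apply_pow (Subfield.inclusion (H.mono j)) _ (H.comm j) (l j / l i)
      (Subfield.inclusion (H.le hij) x)
    rw [H.div_mul_div hij (Nat.le_succ j)] at h2
    exact h1.trans h2

/-- The transition map `E i (t, τ i) → E j (t, τ j)`, `P(t) ↦ P(t ^ (l j / l i))`. -/
noncomputable def trans (H : TransitionsDefined E τ l) (i j : ℕ) (hij : i ≤ j) :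
    TwistedFrac (E i) (τ i) →+* TwistedFrac (E j) (τ j) :=
  TwistedFrac.map (Subfield.inclusion (H.le hij)) (l j / l i) (H.div_pos' hij) (H.comm' hij)

lemma trans_monomial (H : TransitionsDefined E τ l) (i j : ℕ) (hij : i ≤ j) (n : ℕ) (x : E i) :
    H.trans i j hij
      (TwistedFrac.num (τ i) (SkewPolynomial.monomial n (Twist.of (τ i) x))) =
    TwistedFrac.num (τ j) (SkewPolynomial.monomial (l j / l i * n)
      (Twist.of (τ j) (Subfield.inclusion (H.le hij) x))) := by
  rw [trans, TwistedFrac.map_num, TwistedFrac.polyMap_monomial]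

instance directedSystem (H : TransitionsDefined E τ l) : DirectedSystem (fun n => TwistedFrac (E n) (τ n))
    (fun i j hij => H.trans i j hij) where
  map_self i x := by
    have : H.trans i i le_rfl = RingHom.id _ := TwistedFrac.hom_ext fun n x => by
      rw [trans_monomial, Nat.div_self (H.pos i), one_mul]
      rfl
    rw [this]
    rfl
  map_map k j i hij hjk x := by
    have : (H.trans j k hjk).comp (H.trans i j hij) = H.trans i k (hij.trans hjk) :=
      TwistedFrac.hom_ext fun n x => by
        rw [RingHom.comp_apply, trans_monomial, trans_monomial, trans_monomial, ← mul_assoc,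
          H.div_mul_div hij hjk]
        rfl
    exact congrArg (fun f => f x) this

/-- The direct limit of the fields `E n (t, τ n)` along the transition maps. -/
def Limit (H : TransitionsDefined E τ l) : Type u :=
  DirectLimit (fun n => TwistedFrac (E n) (τ n)) (fun i j hij => H.trans i j hij)

noncomputable instance (H : TransitionsDefined E τ l) : DivisionRing H.Limit :=
  inferInstanceAs (DivisionRing
    (DirectLimit (fun n => TwistedFrac (E n) (τ n)) (fun i j hij => H.trans i j hij)))

end TransitionsDefined

/-- A tower of cyclic outer Galois extensions `E n / k` of degree `d n`, where the `E n` are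
subfields of `h` with union `h` and `σ n` generates `Gal(E n / k)`, in a compatible way. -/
structure IsCyclicOuterTower (k : Subfield h) (E : ℕ → Subfield h) (d : ℕ → ℕ)
    (σ : ∀ n, E n ≃+* E n) : Prop where
  base : ∀ n, k ≤ E n
  mono : ∀ n, E n ≤ E (n + 1)
  exhaust : ∀ x : h, ∃ n, x ∈ E n
  galois : ∀ n, IsGaloisExt (Subfield.inclusion (base n))
  outer : ∀ n, IsOuterExt (Subfield.inclusion (base n))
  degree : ∀ n, HasDegree (Subfield.inclusion (base n)) (d n)
  generator : ∀ n, Subgroup.zpowers (σ n : RingAut (E n)) = Gal (Subfield.inclusion (base n))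
  compatible : ∀ m n, m ≤ n → ∀ (x : h) (hm : x ∈ E m) (hn : x ∈ E n),
    (σ n ⟨x, hn⟩ : h) = (σ m ⟨x, hm⟩ : h)

/-- The divisibility conditions on sequences of natural numbers `a` and `l`, the `l n` being
positive. The quotients `l (n + 1) / l n` are exact. -/
structure Admissible (d a l : ℕ → ℕ) : Prop where
  pos : ∀ n, 0 < l n
  dvd : ∀ n, l n ∣ l (n + 1)
  dvd_sub : ∀ n, (d n : ℤ) ∣ ((a (n + 1) * (l (n + 1) / l n) : ℕ) : ℤ) - (a n : ℤ)
  dvd_mul : ∀ n, d n ∣ l n * a n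

end Tower

end TwistedTower

/-! The condition `d n ∣ l n * a n` with `a = 1` says `d n ∣ l n`. An outer Galois extension of
degree `d` has exactly `d` automorphisms (`card_gal`), so `σ n ^ l n = 1` and `t ^ l n` is central
in the `n`-th field. Elements of the center of `k` are central in every `E n`, because conjugation
by them is trivial on `k` and the extension is outer. The transition maps send `t ^ l n` to `t ^ l
(n+1)`; hence these powers define one element `T` of the limit `H`, and `F(T)` lies in the center of
`H`.

Let `L / F(T)` be Galois with group `G` and `L ⊆ F((T))`. The candidate extension of `H` is `H ⊗ L`
over `F(T)`. If it has no zero divisors, it is a skew field, being finite-dimensional over `H`. Its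
automorphisms over `H` are those of `L`, and it is outer because `L` is central in it
(`exists_outer_galois_of_noZeroDivisors`).

Flatness reduces the absence of zero divisors to `H ⊗ F((T))`, then to each stage `R(t, σ) ⊗ F((T))`
with `T = t ^ l`. There `r ⊗ y ↦ r * y(t ^ l)` maps into skew Laurent series, where nonzero elements
are invertible, and no nonzero tensor goes to zero (`noZeroDivisors_twistedFrac_tensorProduct`): a
relation `∑ p_i(t) y_i(t ^ l) = 0`, read on one residue class of exponents modulo `l` through a
linear functional `R → F`, is a linear relation over `F[T]` between the `y_i`. Skew series are
modelled as ordinary Laurent series over `AddMonoid.End R`, with `a t ^ m` acting as `x ↦ a * σ ^ m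
(x)` in degree `m`.

For the existence of `l` and the transition maps, the Chinese remainder theorem gives ratios `l
(n+1) / l n` congruent to `1` modulo `d n` and divisible by `d (n+1) / d n`. -/

namespace TwistedTower

/-! ### Degree and Galois group of outer Galois extensions -/

section Degree

/-- The common core of the Dedekind and Artin arguments: below a solution of minimal support,
killing one more coordinate forces zero. -/
lemma exists_minimal_support {ι K : Type*} [Finite ι] [Zero K] (P : (ι → K) → Prop)
    (h : ∃ x, x ≠ 0 ∧ P x) : ∃ x, x ≠ 0 ∧ P x ∧
      ∀ y, P y → (∀ i, x i = 0 → y i = 0) → ∀ i, x i ≠ 0 → y i = 0 → y = 0 := by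
  obtain ⟨x, ⟨hx0, hx⟩, hmin⟩ := WellFounded.has_min
    (measure fun x : ι → K => (Function.support x).ncard).wf {x | x ≠ 0 ∧ P x} h
  refine ⟨x, hx0, hx, fun y hy hs i hi hyi => ?_⟩
  by_contra h0
  exact hmin y ⟨h0, hy⟩ (Set.ncard_lt_ncard ((Set.ssubset_iff_of_subset fun j => mt (hs j)).mpr
    ⟨i, hi, not_not.mpr hyi⟩) (Set.toFinite _))

variable {k K : Type u} [DivisionRing k] [DivisionRing K] {f : k →+* K}

/-- Dedekind's independence of automorphisms, for outer extensions. -/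
lemma eq_zero_of_forall_sum_eq_zero (ho : IsOuterExt f) {n : ℕ} {s : Fin n → RingAut K}
    (hs : ∀ i, s i ∈ Gal f) (hinj : Function.Injective s) (c : Fin n → K)
    (hc : ∀ x, ∑ i, s i x * c i = 0) : c = 0 := by
  by_contra hne
  obtain ⟨c, hc0, hc, hmin⟩ := exists_minimal_support
    (fun c : Fin n → K => ∀ x, ∑ i, s i x * c i = 0) ⟨c, hne, hc⟩
  obtain ⟨i₀, hi₀⟩ := Function.ne_iff.mp hc0
  -- Replace `x` by `x * y` in the relation and subtract the relation multiplied on the right by `(c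
  -- i₀)⁻¹ * s i₀ y * c i₀`. The coefficient at `i₀` cancels, so minimality kills all the others.
  have key : ∀ y i, s i y * c i - c i * ((c i₀)⁻¹ * s i₀ y * c i₀) = 0 := fun y => by
    have := hmin (fun i => s i y * c i - c i * ((c i₀)⁻¹ * s i₀ y * c i₀)) (fun x => by
      have h1 := hc (x * y)
      have h2 := congrArg (· * ((c i₀)⁻¹ * s i₀ y * c i₀)) (hc x)
      simp only [Finset.sum_mul, zero_mul] at h2
      rw [← sub_eq_zero.mpr (h1.trans h2.symm), ← Finset.sum_sub_distrib]
      simp only [map_mul, mul_sub, mul_assoc]) (fun i h => by simp [h]) i₀ hi₀ (by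
        simp only [mul_assoc]
        rw [mul_inv_cancel_left₀ hi₀, sub_self])
    exact fun i => congrFun this i
  -- By `key`, `s i` is `s i₀` followed by conjugation by `c i * (c i₀)⁻¹`. Both automorphisms fix
  -- `k`, hence so does the conjugation, which is trivial by outerness. The support is thus a single
  -- point, and `x = 1` gives the contradiction.
  have huniq : ∀ i, c i ≠ 0 → i = i₀ := fun i hi => hinj <| RingEquiv.ext fun y => by
    have hu : c i * (c i₀)⁻¹ ≠ 0 := mul_ne_zero hi (inv_ne_zero hi₀)
    have h1 : ∀ y, s i y = c i * (c i₀)⁻¹ * s i₀ y * (c i * (c i₀)⁻¹)⁻¹ := fun y => by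
      rw [eq_mul_inv_iff_mul_eq₀ hu, ← mul_assoc, sub_eq_zero.mp (key y i)]
      simp only [mul_assoc, mul_inv_cancel₀ hi₀, mul_one]
    rw [h1, ho _ hu fun x => ?_]
    have := h1 (f x)
    rw [hs i x, hs i₀ x] at this
    exact this.symm
  have := hc 1
  rw [Finset.sum_eq_single i₀ (fun i _ hi => by
    rw [not_imp_comm.mp (huniq i) hi, mul_zero]) (by simp)] at this
  simp only [map_one, one_mul] at this
  exact hi₀ this

lemma le_degree (ho : IsOuterExt f) {d : ℕ} (hd : HasDegree f d) {n : ℕ} {s : Fin n → RingAut K}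
    (hs : ∀ i, s i ∈ Gal f) (hinj : Function.Injective s) : n ≤ d := by
  let : Module k K := Module.compHom K f
  have hd : Module.rank k K = d := hd
  by_contra! hlt
  have : Module.Finite k K := Module.rank_lt_aleph0_iff.mp (hd ▸ Cardinal.natCast_lt_aleph0)
  let b : Module.Basis (Fin d) k K :=
    Module.finBasisOfFinrankEq k K (Module.finrank_eq_of_rank_eq hd)
  -- The unknowns stand to the right of the coefficients `s i (b j)`, so the system is linear over
  -- the opposite field. With `d < n` equations it has a nonzero solution, which contradicts
  -- independence.
  let Φ : (Fin n → Kᵐᵒᵖ) →ₗ[Kᵐᵒᵖ] (Fin d → Kᵐᵒᵖ) :=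
    LinearMap.pi fun j => ∑ i, (LinearMap.toSpanSingleton Kᵐᵒᵖ Kᵐᵒᵖ
      (MulOpposite.op (s i (b j)))).comp (LinearMap.proj i)
  obtain ⟨c, hc, hc0⟩ := Submodule.exists_mem_ne_zero_of_ne_bot
    (LinearMap.ker_ne_bot_of_finrank_lt (f := Φ) (by simpa using hlt))
  refine hc0 (funext fun i => MulOpposite.unop_injective
    (congrFun (eq_zero_of_forall_sum_eq_zero ho hs hinj (fun i => (c i).unop) fun x => ?_) i))
  have hb : ∀ j, ∑ i, s i (b j) * (c i).unop = 0 := fun j => by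
    have := congrArg MulOpposite.unop (congrFun (LinearMap.mem_ker.mp hc) j)
    simpa [Φ, LinearMap.pi_apply, Finset.unop_sum] using this
  rw [← b.sum_repr x]
  have hsm : ∀ (a : k) (z : K), a • z = f a * z := fun _ _ => rfl
  simp only [map_sum, Finset.sum_mul, hsm, map_mul]
  rw [Finset.sum_comm]
  refine Finset.sum_eq_zero fun j _ => ?_
  simp only [fun i => hs i (b.repr x j), mul_assoc]
  rw [← Finset.mul_sum, hb, mul_zero]

lemma finite_gal (ho : IsOuterExt f) {d : ℕ} (hd : HasDegree f d) : Finite (Gal f) := by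
  by_contra h
  rw [not_finite_iff_infinite] at h
  let e := (Infinite.natEmbedding (Gal f))
  have := le_degree ho hd (n := d + 1) (s := fun i => (e i : RingAut K)) (fun i => (e i).2)
    (Subtype.val_injective.comp (e.injective.comp Fin.val_injective))
  omega

/-- Artin's theorem for outer Galois extensions of skew fields. -/
lemma card_gal (hg : IsGaloisExt f) (ho : IsOuterExt f) {d : ℕ} (hd : HasDegree f d) :
    Nat.card (Gal f) = d := by
  have := finite_gal ho hd
  let : Module k K := Module.compHom K f
  have hd' : Module.rank k K = d := hd
  let e := (Finite.equivFin (Gal f)).symm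
  refine le_antisymm (le_degree ho hd (s := fun i => (e i : RingAut K)) (fun i => (e i).2)
    (Subtype.val_injective.comp e.injective)) ?_
  by_contra! hlt
  have : Module.Finite k K := Module.rank_lt_aleph0_iff.mp (hd' ▸ Cardinal.natCast_lt_aleph0)
  let b : Module.Basis (Fin d) k K :=
    Module.finBasisOfFinrankEq k K (Module.finrank_eq_of_rank_eq hd')
  let Φ : (Fin d → K) →ₗ[K] (Fin (Nat.card (Gal f)) → K) :=
    LinearMap.pi fun i => ∑ j, (LinearMap.toSpanSingleton K K
      ((e i : RingAut K) (b j))).comp (LinearMap.proj j)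
  obtain ⟨x, hx, hx0⟩ := Submodule.exists_mem_ne_zero_of_ne_bot
    (LinearMap.ker_ne_bot_of_finrank_lt (f := Φ) (by simpa using hlt))
  obtain ⟨x, hx0, hx, hmin⟩ := exists_minimal_support
    (fun x : Fin d → K => ∀ s ∈ Gal f, ∑ j, x j * s (b j) = 0) ⟨x, hx0, fun s hs => by
      have := congrFun (LinearMap.mem_ker.mp hx) (e.symm ⟨s, hs⟩)
      simpa [Φ, LinearMap.pi_apply] using this⟩
  obtain ⟨j₀, hj₀⟩ := Function.ne_iff.mp hx0
  -- Applying `s` to the coordinates of a solution permutes the equations. The normalized solution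
  -- minus its image under `s` vanishes at `j₀`, hence everywhere. The coordinates therefore lie in
  -- `k`, and the equation for `s = 1` contradicts the independence of `b`.
  have hfix : ∀ j, ∀ s ∈ Gal f, s ((x j₀)⁻¹ * x j) = (x j₀)⁻¹ * x j := fun j s hs => by
    have := hmin (fun j => s ((x j₀)⁻¹ * x j) - (x j₀)⁻¹ * x j) (fun s' hs' => by
      simp only [sub_mul, Finset.sum_sub_distrib, mul_assoc, ← Finset.mul_sum, hx s' hs', mul_zero,
        sub_zero]
      have h1 := congrArg s (hx (s⁻¹ * s') (mul_mem (inv_mem hs) hs'))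
      have h2 : ∀ z, s ((s⁻¹ * s') z) = s' z := fun z => by
        rw [← RingAut.mul_apply, mul_inv_cancel_left]
      simp only [map_sum, map_mul, h2, map_zero] at h1
      simp only [map_mul, mul_assoc, ← Finset.mul_sum, h1, mul_zero])
      (fun j h => by simp [h]) j₀ hj₀ (by rw [inv_mul_cancel₀ hj₀, map_one, sub_self])
    exact sub_eq_zero.mp (congrFun this j)
  choose a ha using fun j => hg _ (hfix j)
  have hsum : ∑ j, a j • b j = 0 := by
    have h1 := hx 1 (one_mem _)
    have hsm : ∀ (a : k) (z : K), a • z = f a * z := fun _ _ => rfl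
    simp only [hsm, ha, mul_assoc, ← Finset.mul_sum]
    simp only [RingAut.one_apply] at h1
    rw [h1, mul_zero]
  have h0 := Fintype.linearIndependent_iff.mp b.linearIndependent a hsum j₀
  have := ha j₀
  rw [h0, map_zero, inv_mul_cancel₀ hj₀] at this
  exact zero_ne_one this

lemma pow_degree_eq_one (hg : IsGaloisExt f) (ho : IsOuterExt f) {d : ℕ} (hd : HasDegree f d)
    {s : RingAut K} (hs : s ∈ Gal f) : s ^ d = 1 := by
  have := pow_card_eq_one' (x := (⟨s, hs⟩ : Gal f))
  rw [card_gal hg ho hd] at this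
  exact congrArg Subtype.val this

lemma degree_pos {d : ℕ} (hd : HasDegree f d) : 0 < d := by
  let : Module k K := Module.compHom K f
  have hd' : Module.rank k K = d := hd
  rcases d.eq_zero_or_pos with rfl | h
  · rw [Nat.cast_zero, rank_zero_iff] at hd'
    exact absurd (Subsingleton.elim (0 : K) 1) zero_ne_one
  · exact h

lemma degree_dvd {M : Type u} [DivisionRing M] {g : K →+* M} {d e : ℕ} (hd : HasDegree f d)
    (he : HasDegree (g.comp f) e) : d ∣ e := by
  let : Module k K := Module.compHom K f
  let : Module K M := Module.compHom M g
  let : Module k M := Module.compHom M (g.comp f)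
  have : IsScalarTower k K M := ⟨fun a b c => by
    change g (f a * b) * c = g (f a) * (g b * c)
    rw [map_mul, mul_assoc]⟩
  have hd' : Module.rank k K = d := hd
  have he' : Module.rank k M = e := he
  have h := rank_mul_rank k K M
  rw [hd', he'] at h
  have hd0 := degree_pos hd
  -- The tower law holds for cardinals; finiteness of the second factor turns it into a divisibility
  -- of natural numbers.
  have hlt : Module.rank K M < Cardinal.aleph0 := by
    refine lt_of_le_of_lt ?_ (Cardinal.natCast_lt_aleph0 (n := e))
    rw [← h]
    exact Cardinal.le_mul_left (by exact_mod_cast hd0.ne')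
  obtain ⟨m, hm⟩ := Cardinal.lt_aleph0.mp hlt
  rw [hm] at h
  exact ⟨m, by exact_mod_cast h.symm⟩

end Degree

/-! ### Arithmetic of the tower: the sequence `l` and the transition maps -/

section Tower

variable {h : Type u} [DivisionRing h] {k : Subfield h} {E : ℕ → Subfield h} {d : ℕ → ℕ}
  {σ : ∀ n, E n ≃+* E n}

namespace IsCyclicOuterTower

lemma mem_gal (hT : IsCyclicOuterTower k E d σ) (n : ℕ) :
    (σ n : RingAut (E n)) ∈ Gal (Subfield.inclusion (hT.base n)) :=
  hT.generator n ▸ Subgroup.mem_zpowers _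

lemma pow_eq_one (hT : IsCyclicOuterTower k E d σ) (n : ℕ) : (σ n : RingAut (E n)) ^ d n = 1 :=
  pow_degree_eq_one (hT.galois n) (hT.outer n) (hT.degree n) (hT.mem_gal n)

lemma dvd_succ (hT : IsCyclicOuterTower k E d σ) (n : ℕ) : d n ∣ d (n + 1) :=
  degree_dvd (g := Subfield.inclusion (hT.mono n)) (hT.degree n) (hT.degree (n + 1))

/-- Elements of the center of `k` are central in `E n`. -/
lemma commute (hT : IsCyclicOuterTower k E d σ) (n : ℕ) (c : Subring.center k) (x : E n) :
    Subfield.inclusion (hT.base n) c * x = x * Subfield.inclusion (hT.base n) c := by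
  by_cases hc : Subfield.inclusion (hT.base n) (c : k) = 0
  · rw [hc, zero_mul, mul_zero]
  · have := hT.outer n _ hc (fun y => by
      rw [← map_mul, ← Subring.mem_center_iff.mp c.2 y, map_mul, mul_inv_cancel_right₀ hc]) x
    rwa [mul_inv_eq_iff_eq_mul₀ hc] at this

lemma exists_admissible (hT : IsCyclicOuterTower k E d σ)
    (hd : ∀ n, Nat.Coprime (d (n + 1) / d n) (d n)) :
    ∃ l : ℕ → ℕ, Admissible d (fun _ => 1) l := by
  have hpos : ∀ n, 0 < d n := fun n => degree_pos (hT.degree n)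
  have hm : ∀ n, ∃ m, 0 < m ∧ d (n + 1) / d n ∣ m ∧ (d n : ℤ) ∣ (m : ℤ) - 1 := fun n => by
    obtain ⟨m, h1, h2⟩ := Nat.chineseRemainder (hd n) 0 1
    -- The Chinese remainder may be `0`. Adding `d (n + 1)`, a multiple of both moduli, makes it
    -- positive without changing the congruences.
    refine ⟨m + d (n + 1), Nat.add_pos_right _ (hpos _),
      Nat.dvd_add ((Nat.modEq_zero_iff_dvd).mp h1) (Nat.div_dvd_of_dvd (hT.dvd_succ n)), ?_⟩
    have h3 : (d n : ℤ) ∣ (m : ℤ) - (1 : ℕ) := (Nat.modEq_iff_dvd.mp h2.symm)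
    have h4 : (d n : ℤ) ∣ (d (n + 1) : ℤ) := by exact_mod_cast hT.dvd_succ n
    have := dvd_add h3 h4
    push_cast at this ⊢
    rwa [sub_add_eq_add_sub] at this
  choose m hm0 hm1 hm2 using hm
  -- The factor `d 0` starts the induction for `d n ∣ l n`; each `m n` then supplies the missing
  -- factor `d (n + 1) / d n`.
  let l : ℕ → ℕ := fun n => d 0 * ∏ i ∈ Finset.range n, m i
  have hl0 : ∀ n, 0 < l n := fun n => Nat.mul_pos (hpos 0) (Finset.prod_pos fun i _ => hm0 i)
  have hls : ∀ n, l (n + 1) = l n * m n := fun n => by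
    simp only [l, Finset.prod_range_succ, mul_assoc]
  refine ⟨l, hl0, fun n => ⟨m n, hls n⟩, fun n => ?_, fun n => ?_⟩
  · rw [hls, Nat.mul_div_cancel_left _ (hl0 n), one_mul]
    simpa using hm2 n
  · rw [mul_one]
    induction n with
    | zero => simp [l]
    | succ n ih =>
      rw [hls, ← Nat.mul_div_cancel' (hT.dvd_succ n)]
      exact mul_dvd_mul ih (hm1 n)

lemma transitionsDefined (hT : IsCyclicOuterTower k E d σ) {l : ℕ → ℕ}
    (hl : Admissible d (fun _ => 1) l) : TransitionsDefined E σ l where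
  mono := hT.mono
  pos := hl.pos
  dvd := hl.dvd
  comm n x := by
    have hpow : ∀ (m : ℕ) (x : E n), Subfield.inclusion (hT.mono n) ((σ n ^ m : RingAut (E n)) x) =
        (σ (n + 1) ^ m : RingAut (E (n + 1))) (Subfield.inclusion (hT.mono n) x) := by
      intro m x
      have := TwistedFrac.apply_pow (σ := σ n) (τ := σ (n + 1)) (Subfield.inclusion (hT.mono n)) 1
        (fun x => Subtype.ext (by
          rw [pow_one]
          exact (hT.compatible n (n + 1) n.le_succ x x.2 (hT.mono n x.2)).symm)) m x
      rwa [one_mul] at this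
    -- On `E n` the power of `σ (n + 1)` is that of `σ n`, whose exponent `l (n + 1) / l n` is `1`
    -- modulo `d n`.
    rw [← hpow]
    congr 1
    have h1 := hl.dvd_sub n
    rw [one_mul] at h1
    have h2 : 1 ≡ l (n + 1) / l n [MOD d n] := (Nat.modEq_iff_dvd).mpr h1
    have h3 := pow_eq_pow_of_modEq h2 (hT.pow_eq_one n)
    rw [← h3, pow_one]

end IsCyclicOuterTower

end Tower

/-! ### Tensor products `H ⊗ L` as outer Galois extensions of `H` -/

section Tensor

open scoped TensorProduct

variable {Z H L : Type u} [Field Z] [DivisionRing H] [Algebra Z H] [Field L] [Algebra Z L]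

/-- A finite-dimensional algebra without zero divisors over a skew field is a skew field. -/
lemma isUnit_or_eq_zero_tensorProduct [FiniteDimensional Z L] [NoZeroDivisors (H ⊗[Z] L)]
    (a : H ⊗[Z] L) : IsUnit a ∨ a = 0 := by
  have hinv : ∀ a : H ⊗[Z] L, a ≠ 0 → ∃ b, b * a = 1 := fun a ha => by
    have : Module.Finite H (H ⊗[Z] L) :=
      Module.Finite.of_basis (Algebra.TensorProduct.basis H (Module.finBasis Z L))
    -- Right multiplication by `a` is left `H`-linear and injective on a finite-dimensional space,
    -- hence surjective: `a` has a left inverse.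
    let φ : H ⊗[Z] L →ₗ[H] H ⊗[Z] L :=
      { toFun := fun x => x * a
        map_add' := fun x y => add_mul x y a
        map_smul' := fun c x => smul_mul_assoc c x a }
    have hφ : Function.Injective φ := fun x y hxy => mul_right_cancel₀ ha hxy
    exact LinearMap.injective_iff_surjective.mp hφ 1
  refine or_iff_not_imp_right.mpr fun ha => ?_
  have : Nontrivial (H ⊗[Z] L) := ⟨a, 0, ha⟩
  obtain ⟨b, hb⟩ := hinv a ha
  obtain ⟨c, hc⟩ := hinv b (fun h => by simp [h] at hb)
  have hac : a = c := by rw [← one_mul a, ← hc, mul_assoc, hb, mul_one]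
  exact ⟨⟨a, b, by rw [hac, hc], hb⟩, rfl⟩

/-- In coordinates along a basis of `H` over `Z`, the group acts on each coefficient in `L`
separately, so invariant tensors have coefficients in `Z`. -/
lemma mem_range_of_forall_lTensor_eq [IsGalois Z L] (x : H ⊗[Z] L)
    (hx : ∀ g : L ≃ₐ[Z] L, Algebra.TensorProduct.map (AlgHom.id Z H) g.toAlgHom x = x) :
    ∃ y : H, y ⊗ₜ[Z] (1 : L) = x := by
  classical
  let b := Module.Basis.ofVectorSpace Z H
  let e := TensorProduct.equivFinsuppOfBasisLeft (N := L) b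
  have he : ∀ (g : L ≃ₐ[Z] L) x i,
      e (Algebra.TensorProduct.map (AlgHom.id Z H) g.toAlgHom x) i = g (e x i) := fun g x i => by
    induction x with
    | zero => simp
    | tmul a y => simp [e]
    | add x y hx hy => simp only [map_add, Finsupp.add_apply, hx, hy]
  have hmem : ∀ i, ∃ z : Z, algebraMap Z L z = e x i := fun i =>
    (InfiniteGalois.mem_range_algebraMap_iff_fixed (e x i)).mpr fun g => by rw [← he, hx]
  choose z hz using hmem
  refine ⟨(e x).sum fun i _ => z i • b i, ?_⟩
  have h1 : x = e.symm (e x) := (e.symm_apply_apply x).symm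
  conv_rhs => rw [h1, TensorProduct.equivFinsuppOfBasisLeft_symm_apply]
  rw [Finsupp.sum, Finsupp.sum, TensorProduct.sum_tmul]
  refine Finset.sum_congr rfl fun i _ => ?_
  rw [TensorProduct.smul_tmul, Algebra.smul_def, hz, mul_one]

lemma includeRight_commute (y : L) (x : H ⊗[Z] L) :
    ((1 : H) ⊗ₜ[Z] y) * x = x * ((1 : H) ⊗ₜ[Z] y) := by
  induction x with
  | zero => simp
  | tmul a z => simp [mul_comm]
  | add x y hx hy => rw [mul_add, add_mul, hx, hy]

/-- A root in `H ⊗ L` of a polynomial which splits in `L` lies in `L`. -/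
lemma exists_root_of_splits [NoZeroDivisors (H ⊗[Z] L)] {p : Polynomial Z} (hp : p ≠ 0)
    (hs : (p.map (algebraMap Z L)).Splits) (x : H ⊗[Z] L) (hx : Polynomial.aeval x p = 0) :
    ∃ y : L, (1 : H) ⊗ₜ[Z] y = x := by
  -- Since `L` is central in `H ⊗ L`, evaluation at `x` is multiplicative on `L[X]`, and one of the
  -- linear factors must vanish at `x`.
  let : Algebra L (H ⊗[Z] L) :=
    (Algebra.TensorProduct.includeRight : L →ₐ[Z] H ⊗[Z] L).toRingHom.toAlgebra'
      fun y x => includeRight_commute y x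
  have hal : ∀ y : L, algebraMap L (H ⊗[Z] L) y = 1 ⊗ₜ y := fun y => rfl
  have : IsScalarTower Z L (H ⊗[Z] L) := IsScalarTower.of_algebraMap_eq fun z => by
    rw [hal, Algebra.TensorProduct.algebraMap_apply, Algebra.algebraMap_eq_smul_one,
      Algebra.algebraMap_eq_smul_one, TensorProduct.smul_tmul]
  rw [← Polynomial.aeval_map_algebraMap L, hs.eq_prod_roots, map_mul, Polynomial.aeval_C] at hx
  have hlc : algebraMap L (H ⊗[Z] L) (p.map (algebraMap Z L)).leadingCoeff ≠ 0 := by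
    rw [map_ne_zero_iff _ (algebraMap L (H ⊗[Z] L)).injective]
    simpa using hp
  have hprod := (mul_eq_zero.mp hx).resolve_left hlc
  generalize (p.map (algebraMap Z L)).roots = m at hprod
  induction m using Multiset.induction with
  | empty => simp at hprod
  | cons a m ih =>
    rw [Multiset.map_cons, Multiset.prod_cons, map_mul] at hprod
    rcases mul_eq_zero.mp hprod with h | h
    · rw [map_sub, Polynomial.aeval_X, Polynomial.aeval_C, sub_eq_zero] at h
      exact ⟨a, h.symm⟩
    · exact ih h

/-- A ring automorphism of `H ⊗ L` over `H` comes from an automorphism of `L`. -/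
lemma exists_algEquiv_of_ringEquiv [IsGalois Z L] [NoZeroDivisors (H ⊗[Z] L)]
    (s : H ⊗[Z] L ≃+* H ⊗[Z] L) (hs : ∀ y : H, s (y ⊗ₜ 1) = y ⊗ₜ 1) :
    ∃ g : L ≃ₐ[Z] L, ∀ x, s x = Algebra.TensorProduct.map (AlgHom.id Z H) g.toAlgHom x := by
  have hroot : ∀ y : L, ∃ y' : L, (1 : H) ⊗ₜ[Z] y' = s (1 ⊗ₜ y) := fun y => by
    let s' : H ⊗[Z] L →ₐ[Z] H ⊗[Z] L :=
      { (s : H ⊗[Z] L →+* H ⊗[Z] L) with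
        commutes' := fun z => by
          rw [Algebra.TensorProduct.algebraMap_apply]
          exact hs _ }
    -- `s` fixes `Z`, so it sends `1 ⊗ y` to another root of the minimal polynomial of `y`, which
    -- splits in the normal extension `L`.
    refine exists_root_of_splits
      (minpoly.ne_zero (Algebra.IsIntegral.isIntegral (R := Z) y)) (Normal.splits inferInstance y)
      _ ?_
    have := congrArg (s'.comp Algebra.TensorProduct.includeRight) (minpoly.aeval Z y)
    rw [← Polynomial.aeval_algHom_apply, map_zero] at this
    exact this
  have hinj : Function.Injective fun y : L => (1 : H) ⊗ₜ[Z] y :=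
    (Algebra.TensorProduct.includeRight : L →ₐ[Z] H ⊗[Z] L).toRingHom.injective
  choose g hg using hroot
  let g' : L →ₐ[Z] L :=
    { toFun := g
      map_one' := hinj (by
        change 1 ⊗ₜ g 1 = _
        rw [hg, hs])
      map_mul' := fun a b => hinj (by
        have h1 : (1 : H) ⊗ₜ[Z] (a * b) = (1 ⊗ₜ a) * (1 ⊗ₜ b) := by simp
        have h2 : (1 : H) ⊗ₜ[Z] (g a * g b) = (1 ⊗ₜ g a) * (1 ⊗ₜ g b) := by simp
        change 1 ⊗ₜ g (a * b) = 1 ⊗ₜ (g a * g b)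
        rw [hg, h1, h2, map_mul, hg, hg])
      map_zero' := hinj (by
        change 1 ⊗ₜ g 0 = _
        rw [hg]
        simp)
      map_add' := fun a b => hinj (by
        change 1 ⊗ₜ g (a + b) = 1 ⊗ₜ (g a + g b)
        rw [hg, TensorProduct.tmul_add, TensorProduct.tmul_add, map_add, hg, hg])
      commutes' := fun z => hinj (by
        change 1 ⊗ₜ g (algebraMap Z L z) = 1 ⊗ₜ algebraMap Z L z
        rw [hg, Algebra.algebraMap_eq_smul_one, ← TensorProduct.smul_tmul, hs]) }
  refine ⟨AlgEquiv.ofBijective g' (Algebra.IsAlgebraic.algHom_bijective g'), fun x => ?_⟩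
  induction x with
  | zero => simp
  | tmul a y =>
    have h1 : a ⊗ₜ[Z] y = (a ⊗ₜ 1) * (1 ⊗ₜ y) := by simp
    rw [h1, map_mul, hs, ← hg]
    simp [g']
  | add x y hx hy => rw [map_add, map_add, hx, hy]

/-- If `H ⊗ L` has no zero divisors, then it is an outer Galois extension of `H`, with Galois group
that of `L`. -/
theorem exists_outer_galois_of_noZeroDivisors [IsGalois Z L] [FiniteDimensional Z L]
    [NoZeroDivisors (H ⊗[Z] L)] : ∃ (K : Type u) (_ : DivisionRing K) (f : H →+* K),
      IsGaloisExt f ∧ IsOuterExt f ∧ Nonempty (Gal f ≃* (L ≃ₐ[Z] L)) := by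
  have : Nonempty (Fin (Module.finrank Z L)) := ⟨⟨0, Module.finrank_pos⟩⟩
  have : Nontrivial (H ⊗[Z] L) :=
    (Algebra.TensorProduct.basis H (Module.finBasis Z L)).repr.toEquiv.nontrivial
  let : DivisionRing (H ⊗[Z] L) :=
    DivisionRing.ofIsUnitOrEqZero isUnit_or_eq_zero_tensorProduct
  let f : H →+* H ⊗[Z] L := Algebra.TensorProduct.includeLeftRingHom
  have hf : ∀ y, f y = y ⊗ₜ 1 := fun _ => rfl
  let toGal : (L ≃ₐ[Z] L) →* Gal f :=
    { toFun := fun g =>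
        ⟨(Algebra.TensorProduct.congr (AlgEquiv.refl : H ≃ₐ[Z] H) g).toRingEquiv, fun y => by
          simp [hf]⟩
      map_one' := Subtype.ext <| RingEquiv.ext fun x => by
        change Algebra.TensorProduct.map (AlgHom.id Z H) (AlgHom.id Z L) x = x
        simp
      map_mul' := fun g g' => Subtype.ext <| RingEquiv.ext fun x => by
        change Algebra.TensorProduct.map (AlgHom.id Z H) (g.toAlgHom.comp g'.toAlgHom) x =
          Algebra.TensorProduct.map (AlgHom.id Z H) g.toAlgHom
            (Algebra.TensorProduct.map (AlgHom.id Z H) g'.toAlgHom x)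
        induction x with
        | zero => simp
        | tmul a y => simp
        | add x y hx hy => simp only [map_add, hx, hy] }
  have htoGal : ∀ g x, (toGal g : RingAut (H ⊗[Z] L)) x =
      Algebra.TensorProduct.map (AlgHom.id Z H) g.toAlgHom x := fun _ _ => rfl
  refine ⟨H ⊗[Z] L, inferInstance, f, fun y hy => ?_, fun c hc hcf y => ?_,
    ⟨(MulEquiv.ofBijective toGal ⟨fun g g' h => ?_, fun s => ?_⟩).symm⟩⟩
  · exact mem_range_of_forall_lTensor_eq y fun g => by
      rw [← htoGal]
      exact hy _ (toGal g).2
  -- If `c` centralizes `H`, it is central, because it also commutes with the central factor `L`.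
  · suffices h : c * y = y * c by rw [h, mul_inv_cancel_right₀ hc]
    induction y with
    | zero => simp
    | tmul a y =>
      have h1 : a ⊗ₜ[Z] y = f a * (1 ⊗ₜ y) := by simp [hf]
      have h2 : c * f a = f a * c := (mul_inv_eq_iff_eq_mul₀ hc).mp (hcf a)
      rw [h1, ← mul_assoc, h2, mul_assoc, mul_assoc, includeRight_commute]
    | add x y hx hy => rw [mul_add, add_mul, hx, hy]
  · refine AlgEquiv.ext fun y => ?_
    have hinj : Function.Injective fun y : L => (1 : H) ⊗ₜ[Z] y :=
      (Algebra.TensorProduct.includeRight : L →ₐ[Z] H ⊗[Z] L).toRingHom.injective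
    have h1 := congrArg (fun s : Gal f => (s : RingAut (H ⊗[Z] L)) (1 ⊗ₜ y)) h
    exact hinj (by simpa [htoGal] using h1)
  · obtain ⟨g, hg⟩ := exists_algEquiv_of_ringEquiv (s : RingAut (H ⊗[Z] L)) s.2
    exact ⟨g, Subtype.ext <| RingEquiv.ext fun x => (hg x).symm⟩

end Tensor

/-! ### Homomorphisms out of rational function fields -/

section RatFuncHom

/-- Two homomorphisms from a rational function field to a ring are equal as soon as they agree on
the constants and on the indeterminate. -/
lemma ratFunc_ringHom_ext {C W : Type*} [Field C] [Ring W] {f g : RatFunc C →+* W}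
    (hC : ∀ c, f (RatFunc.C c) = g (RatFunc.C c)) (hX : f RatFunc.X = g RatFunc.X) : f = g := by
  have hp : ∀ p : Polynomial C, f (algebraMap _ _ p) = g (algebraMap _ _ p) := fun p => by
    have : f.comp (algebraMap (Polynomial C) (RatFunc C)) =
        g.comp (algebraMap (Polynomial C) (RatFunc C)) :=
      Polynomial.ringHom_ext (by simpa using hC) (by simpa using hX)
    exact congrArg (fun φ => φ p) this
  ext x
  induction x using RatFunc.induction_on with
  | _ p q hq =>
    have hq' : algebraMap (Polynomial C) (RatFunc C) q ≠ 0 := by simpa using hq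
    have h1 : ∀ φ : RatFunc C →+* W, φ (algebraMap _ _ p / algebraMap _ _ q) =
        φ (algebraMap _ _ q)⁻¹ * φ (algebraMap _ _ p) := fun φ => by
      rw [← map_mul, div_eq_inv_mul]
    -- The target may be noncommutative and have zero divisors; only the uniqueness of inverses is
    -- used.
    have h2 : f (algebraMap _ _ q)⁻¹ = g (algebraMap _ _ q)⁻¹ := by
      have h3 : f (algebraMap (Polynomial C) (RatFunc C) q)⁻¹ * g (algebraMap _ _ q) = 1 := by
        rw [← hp, ← map_mul, inv_mul_cancel₀ hq', map_one]
      have h4 : g (algebraMap (Polynomial C) (RatFunc C) q) * g (algebraMap _ _ q)⁻¹ = 1 := by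
        rw [← map_mul, mul_inv_cancel₀ hq', map_one]
      rw [← mul_one (f _), ← h4, ← mul_assoc, h3, one_mul]
    rw [h1, h1, h2, hp]

end RatFuncHom

/-! ### Invertible Laurent series over a noncommutative ring -/

section LaurentUnit

/-- Up to a power of the variable, the series is a power series with invertible constant term. -/
lemma isUnit_of_isUnit_leadingCoeff {S : Type*} [Ring S] {f : LaurentSeries S}
    (hf : IsUnit f.leadingCoeff) : IsUnit f := by
  obtain ⟨u, hu⟩ := hf
  have h1 : PowerSeries.constantCoeff f.powerSeriesPart = u := by
    rw [← PowerSeries.coeff_zero_eq_constantCoeff_apply, LaurentSeries.powerSeriesPart_coeff, hu,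
      HahnSeries.leadingCoeff_eq]
    simp
  rw [← LaurentSeries.single_order_mul_powerSeriesPart f]
  refine IsUnit.mul ?_ (IsUnit.map (HahnSeries.ofPowerSeries ℤ S)
    ⟨⟨_, _, PowerSeries.mul_invOfUnit _ u h1, PowerSeries.invOfUnit_mul _ u h1⟩, rfl⟩)
  exact ⟨⟨HahnSeries.single f.order 1, HahnSeries.single (-f.order) 1, by simp, by simp⟩, rfl⟩

end LaurentUnit

/-! ### Skew Laurent series as series of additive endomorphisms -/

section Series

variable {R : Type u} [DivisionRing R] (σ : R ≃+* R)

/-- The additive endomorphism `x ↦ a * σ ^ m (x)`. -/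
def twistEnd (a : R) (m : ℤ) : AddMonoid.End R :=
  (AddMonoidHom.mulLeft a).comp ((σ ^ m : RingAut R) : R ≃+* R).toAddEquiv.toAddMonoidHom

lemma twistEnd_apply (a : R) (m : ℤ) (x : R) :
    twistEnd σ a m x = a * (σ ^ m : RingAut R) x := rfl

lemma twistEnd_add (a b : R) (m : ℤ) :
    twistEnd σ (a + b) m = twistEnd σ a m + twistEnd σ b m :=
  AddMonoidHom.ext fun _ => add_mul _ _ _

lemma twistEnd_zero (m : ℤ) : twistEnd σ 0 m = 0 :=
  AddMonoidHom.ext fun _ => zero_mul _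

lemma twistEnd_mul (a b : R) (m n : ℤ) :
    twistEnd σ a m * twistEnd σ b n = twistEnd σ (a * (σ ^ m : RingAut R) b) (m + n) :=
  AddMonoidHom.ext fun x => by
    change a * (σ ^ m : RingAut R) (b * (σ ^ n : RingAut R) x) =
      a * (σ ^ m : RingAut R) b * (σ ^ (m + n) : RingAut R) x
    rw [map_mul, zpow_add, RingAut.mul_apply, mul_assoc]

lemma twistEnd_one_zero : twistEnd σ 1 0 = 1 :=
  AddMonoidHom.ext fun x => one_mul x

lemma twistEnd_injective (m : ℤ) : Function.Injective (twistEnd σ · m) := fun a b h => by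
  have := DFunLike.congr_fun h (1 : R)
  simpa [twistEnd_apply] using this

lemma isUnit_twistEnd {a : R} (ha : a ≠ 0) (m : ℤ) : IsUnit (twistEnd σ a m) := by
  have h1 : twistEnd σ a m * twistEnd σ ((σ ^ (-m) : RingAut R) a⁻¹) (-m) = 1 := by
    rw [twistEnd_mul, ← RingAut.mul_apply, ← zpow_add, add_neg_cancel, zpow_zero,
      RingAut.one_apply, mul_inv_cancel₀ ha, twistEnd_one_zero]
  have h2 : twistEnd σ ((σ ^ (-m) : RingAut R) a⁻¹) (-m) * twistEnd σ a m = 1 := by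
    rw [twistEnd_mul, ← map_mul, neg_add_cancel, inv_mul_cancel₀ ha, map_one, twistEnd_one_zero]
  exact ⟨⟨_, _, h1, h2⟩, rfl⟩

/-- The Laurent series with coefficients in `AddMonoid.End R` which represent skew Laurent series
in `R((t, σ))`. -/
def IsTwisted (f : LaurentSeries (AddMonoid.End R)) : Prop :=
  ∀ m, ∃ a, f.coeff m = twistEnd σ a m

variable {σ}

/-- The leading coefficient is some `x ↦ a * σ ^ m (x)` with `a ≠ 0`, which is bijective. The
inverse is only claimed in the full ring of series over `AddMonoid.End R`; this is all that is
needed to extend `polyExpand` to fractions and to exclude zero divisors. -/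
lemma IsTwisted.isUnit {f : LaurentSeries (AddMonoid.End R)} (hf : IsTwisted σ f) (h0 : f ≠ 0) :
    IsUnit f := by
  refine isUnit_of_isUnit_leadingCoeff ?_
  have h1 := HahnSeries.leadingCoeff_ne_zero.mpr h0
  rw [HahnSeries.leadingCoeff_eq] at h1 ⊢
  obtain ⟨a, ha⟩ := hf f.order
  rw [ha] at h1 ⊢
  exact isUnit_twistEnd σ (fun h => h1 (by rw [h, twistEnd_zero])) _

lemma IsTwisted.zero : IsTwisted σ 0 := fun m => ⟨0, by rw [twistEnd_zero]; rfl⟩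

lemma IsTwisted.add {f g : LaurentSeries (AddMonoid.End R)} (hf : IsTwisted σ f)
    (hg : IsTwisted σ g) : IsTwisted σ (f + g) := fun m => by
  obtain ⟨a, ha⟩ := hf m
  obtain ⟨b, hb⟩ := hg m
  exact ⟨a + b, by rw [HahnSeries.coeff_add, ha, hb, twistEnd_add]⟩

variable (σ)

/-- The representation of `R` on itself by left multiplications. -/
def leftMul : R →+* AddMonoid.End R where
  toFun a := twistEnd σ a 0
  map_one' := twistEnd_one_zero σ
  map_mul' a b := by rw [twistEnd_mul, zpow_zero, add_zero]; rfl
  map_zero' := twistEnd_zero σ 0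
  map_add' a b := twistEnd_add σ a b 0

lemma twistEnd_one_pow (n : ℕ) : twistEnd σ 1 1 ^ n = twistEnd σ 1 n := by
  induction n with
  | zero => exact (twistEnd_one_zero σ).symm
  | succ n ih => rw [pow_succ, ih, twistEnd_mul, map_one, mul_one, Nat.cast_succ]

/-- The variable of the ordinary Laurent series is central; the twist `t x = σ(x) t` is carried by
its coefficient `σ`. -/
lemma single_twistEnd_pow_comm (x : R) (n : ℕ) :
    HahnSeries.single 0 (twistEnd σ ((σ ^ n : RingAut R) x) 0) *
        (HahnSeries.single (1 : ℤ) (twistEnd σ 1 1)) ^ n =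
      (HahnSeries.single (1 : ℤ) (twistEnd σ 1 1)) ^ n * HahnSeries.single 0 (twistEnd σ x 0) := by
  rw [HahnSeries.single_pow, twistEnd_one_pow, HahnSeries.single_mul_single,
    HahnSeries.single_mul_single, twistEnd_mul, twistEnd_mul, zpow_natCast, map_one, mul_one,
    one_mul, zero_add, add_zero, zero_add, add_zero]

/-- The expansion `a t ^ n ↦ (a σ ^ n) t ^ n` of twisted polynomials. -/
noncomputable def polyExpand : TwistedPoly R σ →+* LaurentSeries (AddMonoid.End R) :=
  SkewMonoidAlgebra.liftNCRingHom
    (HahnSeries.C.comp ((leftMul σ).comp (Twist.of σ).symm.toRingHom))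
    (powersHom (LaurentSeries (AddMonoid.End R)) (HahnSeries.single 1 (twistEnd σ 1 1)))
    fun {x y} => single_twistEnd_pow_comm σ x (Multiplicative.toAdd y)

lemma polyExpand_monomial (n : ℕ) (a : R) :
    polyExpand σ (SkewPolynomial.monomial n (Twist.of σ a)) =
      HahnSeries.single (n : ℤ) (twistEnd σ a n) := by
  refine (SkewMonoidAlgebra.liftNC_single _ _ _ _).trans ?_
  change HahnSeries.single 0 (twistEnd σ a 0) *
    (HahnSeries.single (1 : ℤ) (twistEnd σ 1 1)) ^ n = _
  rw [HahnSeries.single_pow, twistEnd_one_pow, HahnSeries.single_mul_single, twistEnd_mul, map_one,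
    mul_one, zero_add, zero_add, nsmul_eq_mul, mul_one]

lemma coeff_polyExpand (p : TwistedPoly R σ) (n : ℕ) :
    (polyExpand σ p).coeff n = twistEnd σ ((Twist.of σ).symm (p.coeff n)) n := by
  induction p using SkewPolynomial.induction with
  | h0 => simp [twistEnd_zero]
  | ha k r q _ _ ih =>
    rw [map_add, HahnSeries.coeff_add, ih, SkewPolynomial.coeff_add, map_add, twistEnd_add,
      ← (Twist.of σ).apply_symm_apply r, polyExpand_monomial, SkewPolynomial.coeff_monomial,
      HahnSeries.coeff_single]
    by_cases h : k = n
    · simp [h]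
    · have h' : (n : ℤ) ≠ k := fun h' => h (by exact_mod_cast h'.symm)
      simp [h, h', twistEnd_zero]

lemma polyExpand_injective : Function.Injective (polyExpand σ) := by
  refine (injective_iff_map_eq_zero _).mpr fun p hp => ?_
  ext n
  have h := coeff_polyExpand σ p n
  rw [hp, HahnSeries.coeff_zero, ← twistEnd_zero σ n] at h
  exact (map_eq_zero_iff _ (Twist.of σ).symm.injective).mp (twistEnd_injective σ _ h).symm

lemma isTwisted_polyExpand (p : TwistedPoly R σ) : IsTwisted σ (polyExpand σ p) := by
  induction p using SkewPolynomial.induction with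
  | h0 => simpa using IsTwisted.zero
  | ha k r q _ _ ih =>
    rw [map_add]
    refine IsTwisted.add (fun m => ?_) ih
    rw [← (Twist.of σ).apply_symm_apply r, polyExpand_monomial, HahnSeries.coeff_single]
    by_cases h : m = k
    · exact ⟨_, by rw [if_pos h, h]⟩
    · exact ⟨0, by rw [if_neg h, twistEnd_zero]⟩

open scoped nonZeroDivisors in
/-- The expansion of the elements of `R(t, σ)` as skew Laurent series. -/
noncomputable def expand : TwistedFrac R σ →+* LaurentSeries (AddMonoid.End R) :=
  OreLocalization.universalHom (polyExpand σ)
    (IsUnit.liftRight ((polyExpand σ).toMonoidHom.comp (TwistedPoly R σ)⁰.subtype)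
      fun s => (isTwisted_polyExpand σ s).isUnit <|
        (map_ne_zero_iff _ (polyExpand_injective σ)).mpr (nonZeroDivisors.ne_zero s.2))
    fun _ => rfl

lemma expand_num (p : TwistedPoly R σ) : expand σ (TwistedFrac.num σ p) = polyExpand σ p :=
  OreLocalization.universalHom_commutes (polyExpand σ) _ (fun _ => rfl)

/-- Left fractions: every element of `R(t, σ)` has a denominator. -/
lemma exists_num_mul_eq_num (z : TwistedFrac R σ) :
    ∃ s : TwistedPoly R σ, s ≠ 0 ∧ ∃ p, TwistedFrac.num σ s * z = TwistedFrac.num σ p := by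
  induction z using OreLocalization.ind with
  | _ r s => exact ⟨s, nonZeroDivisors.ne_zero s.2, r, OreLocalization.mul_cancel⟩

lemma num_ne_zero {s : TwistedPoly R σ} (hs : s ≠ 0) : TwistedFrac.num σ s ≠ 0 :=
  (map_ne_zero_iff _ TwistedFrac.num_injective).mpr hs

lemma exists_common_denominator {ι : Type*} (t : Finset ι) (z : ι → TwistedFrac R σ) :
    ∃ s : TwistedPoly R σ, s ≠ 0 ∧
      ∀ i ∈ t, ∃ p, TwistedFrac.num σ s * z i = TwistedFrac.num σ p := by
  classical
  induction t using Finset.induction with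
  | empty => exact ⟨1, one_ne_zero, by simp⟩
  | insert i t _ ih =>
    obtain ⟨s, hs, hst⟩ := ih
    obtain ⟨s', hs', p, hp⟩ := exists_num_mul_eq_num σ (TwistedFrac.num σ s * z i)
    refine ⟨s' * s, mul_ne_zero hs' hs, fun j hj => ?_⟩
    rcases Finset.mem_insert.mp hj with rfl | hj
    · exact ⟨p, by rw [map_mul, mul_assoc, hp]⟩
    · obtain ⟨q, hq⟩ := hst j hj
      exact ⟨s' * q, by rw [map_mul, map_mul, mul_assoc, hq]⟩

end Series

/-! ### The central subfield `C(T)` with `T = t ^ l`, and `R(t, σ) ⊗ C((T))` -/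

section Center

open scoped TensorProduct

variable {R : Type u} [DivisionRing R] (σ : R ≃+* R) {C : Type u} [Field C] [Algebra C R]

lemma smulHom_injective {l : ℕ} (hl : 0 < l) :
    Function.Injective (AddMonoidHom.mulLeft (l : ℤ)) := fun a b h => by
  have : (l : ℤ) ≠ 0 := by exact_mod_cast hl.ne'
  exact mul_left_cancel₀ this h

/-- The homomorphism `C((t)) → C((t))`, `y(t) ↦ y(t ^ l)`, followed by the representation of the
coefficients by left multiplications. -/
noncomputable def centerExpand {l : ℕ} (hl : 0 < l) :
    LaurentSeries C →+* LaurentSeries (AddMonoid.End R) :=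
  (HahnSeries.embDomainRingHom (AddMonoidHom.mulLeft (l : ℤ)) (smulHom_injective hl)
    fun g g' => by
      have : (0 : ℤ) < l := by exact_mod_cast hl
      exact mul_le_mul_iff_right₀ this).comp
  { toFun := fun y => y.map ((leftMul σ).comp (algebraMap C R))
    map_one' := HahnSeries.map_one ((leftMul σ).comp (algebraMap C R)).toMonoidWithZeroHom
    map_mul' := fun _ _ =>
      HahnSeries.map_mul ((leftMul σ).comp (algebraMap C R)).toNonUnitalRingHom
    map_zero' := HahnSeries.ext <| funext fun _ => map_zero ((leftMul σ).comp (algebraMap C R))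
    map_add' := fun _ _ =>
      HahnSeries.ext <| funext fun _ => map_add ((leftMul σ).comp (algebraMap C R)) _ _ }

/-- The coefficient of `t ^ n` in `y(t ^ l)`. -/
noncomputable def stretchCoeff (R : Type u) [DivisionRing R] [Algebra C R] (l : ℕ)
    (y : LaurentSeries C) (n : ℤ) : R :=
  if (l : ℤ) ∣ n then algebraMap C R (y.coeff (n / l)) else 0

lemma coeff_centerExpand {l : ℕ} (hl : 0 < l) (y : LaurentSeries C) (n : ℤ) :
    (centerExpand (R := R) σ hl y).coeff n = twistEnd σ (stretchCoeff R l y n) 0 := by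
  have hl' : (l : ℤ) ≠ 0 := by exact_mod_cast hl.ne'
  rw [stretchCoeff]
  split_ifs with h
  · obtain ⟨m, rfl⟩ := h
    rw [Int.mul_ediv_cancel_left _ hl']
    exact HahnSeries.embDomain_coeff (f := ⟨⟨_, smulHom_injective hl⟩, _⟩)
  · rw [twistEnd_zero]
    refine HahnSeries.embDomain_of_notMem_range (f := ⟨⟨_, smulHom_injective hl⟩, _⟩) ?_
    rintro ⟨m, hm⟩
    exact h ⟨m, hm.symm⟩

lemma centerExpand_single {l : ℕ} (hl : 0 < l) (n : ℤ) (c : C) :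
    centerExpand (R := R) σ hl (HahnSeries.single n c) =
      HahnSeries.single (l * n) (twistEnd σ (algebraMap C R c) 0) := by
  have hl' : (l : ℤ) ≠ 0 := by exact_mod_cast hl.ne'
  ext m : 2
  rw [coeff_centerExpand, stretchCoeff, HahnSeries.coeff_single, HahnSeries.coeff_single]
  by_cases h : (l : ℤ) ∣ m
  · obtain ⟨m, rfl⟩ := h
    rw [Int.mul_ediv_cancel_left _ hl', if_pos (dvd_mul_right _ _)]
    by_cases h : m = n
    · simp [h]
    · rw [if_neg h, if_neg (fun h' => h (mul_left_cancel₀ hl' h')), map_zero, twistEnd_zero]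
  · rw [if_neg h, if_neg, twistEnd_zero]
    rintro rfl
    exact h (dvd_mul_right _ _)

variable {σ}

variable {l : ℕ}

lemma zpow_apply_algebraMap
    (hσ : ∀ c, σ (algebraMap C R c) = algebraMap C R c)
    (m : ℤ) (c : C) :
    (σ ^ m : RingAut R) (algebraMap C R c) = algebraMap C R c := by
  have : (σ : RingAut R) ∈ MulAction.stabilizer (RingAut R) (algebraMap C R c) := hσ c
  exact zpow_mem this m

lemma zpow_apply_stretchCoeff
    (hσ : ∀ c, σ (algebraMap C R c) = algebraMap C R c)
    (m : ℤ) (y : LaurentSeries C) (n : ℤ) :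
    (σ ^ m : RingAut R) (stretchCoeff R l y n) = stretchCoeff R l y n := by
  rw [stretchCoeff]
  split_ifs
  · exact zpow_apply_algebraMap hσ m _
  · exact map_zero _

lemma stretchCoeff_commute (y : LaurentSeries C) (n : ℤ) (x : R) :
    stretchCoeff R l y n * x = x * stretchCoeff R l y n := by
  rw [stretchCoeff]
  split_ifs
  · exact Algebra.commutes _ _
  · rw [zero_mul, mul_zero]

/-- The coefficients of `y` are central in `R` and fixed by `σ`, so they commute with every `x ↦ a *
σ ^ m (x)`. Fractions follow by cancelling the invertible expansion of a denominator. -/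
lemma centerExpand_commute_expand
    (hσ : ∀ c, σ (algebraMap C R c) = algebraMap C R c) (hl : 0 < l)
    (y : LaurentSeries C) (z : TwistedFrac R σ) :
    Commute (centerExpand σ hl y) (expand σ z) := by
  have hp : ∀ p, Commute (centerExpand σ hl y) (polyExpand σ p) := fun p => by
    induction p using SkewPolynomial.induction with
    | h0 => simp
    | ha k r q _ _ ih =>
      rw [map_add]
      refine Commute.add_right ?_ ih
      rw [← (Twist.of σ).apply_symm_apply r, polyExpand_monomial]
      ext m : 2
      rw [HahnSeries.coeff_mul_single, HahnSeries.coeff_single_mul, coeff_centerExpand,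
        twistEnd_mul, twistEnd_mul, zpow_apply_stretchCoeff hσ, zpow_zero, add_zero, zero_add,
        RingAut.one_apply, stretchCoeff_commute]
  obtain ⟨s, hs, p, hsp⟩ := exists_num_mul_eq_num σ z
  have hu : IsUnit (polyExpand σ s) := (isTwisted_polyExpand σ s).isUnit <|
    (map_ne_zero_iff _ (polyExpand_injective σ)).mpr hs
  refine hu.mul_left_cancel ?_
  have h1 := congrArg (expand σ) hsp
  rw [map_mul, expand_num, expand_num] at h1
  rw [← mul_assoc, ← (hp s).eq, mul_assoc, h1, (hp p).eq, ← h1, mul_assoc]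

/-- The coefficient of `t ^ m` in `p(t) y(t ^ l)`. -/
noncomputable def mulCoeff (l : ℕ) (p : TwistedPoly R σ) (y : LaurentSeries C) (m : ℤ) : R :=
  p.sum fun k a => (Twist.of σ).symm a * stretchCoeff R l y (m - k)

/-- A term of degree `k` in `p` contributes to degree `m` only if `l ∣ m - k`, and then `σ ^ k = σ ^
m` because `σ ^ l = 1`. Hence a single power of `σ` occurs in each degree, and the product is again
twisted. -/
lemma coeff_polyExpand_mul_centerExpand
    (hσ : ∀ c, σ (algebraMap C R c) = algebraMap C R c) (hl : 0 < l)
    (hσl : (σ ^ l : RingAut R) = 1)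
    (p : TwistedPoly R σ) (y : LaurentSeries C) (m : ℤ) :
    (polyExpand σ p * centerExpand σ hl y).coeff m = twistEnd σ (mulCoeff l p y m) m := by
  induction p using SkewPolynomial.induction with
  | h0 => simp [mulCoeff, SkewPolynomial.sum_zero_index, twistEnd_zero]
  | ha k r q _ _ ih =>
    have hadd : mulCoeff l (SkewPolynomial.monomial k r + q) y m =
        (Twist.of σ).symm r * stretchCoeff R l y (m - k) + mulCoeff l q y m := by
      rw [mulCoeff, SkewPolynomial.sum_add_index _ _ _ (fun i => by rw [map_zero, zero_mul])
        (fun i a b => by rw [map_add, add_mul]),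
        SkewPolynomial.sum_monomial_index (by rw [map_zero, zero_mul]), mulCoeff]
    rw [map_add, add_mul, HahnSeries.coeff_add, ih, hadd, twistEnd_add]
    congr 1
    nth_rewrite 1 [← (Twist.of σ).apply_symm_apply r]
    rw [polyExpand_monomial, HahnSeries.coeff_single_mul, coeff_centerExpand, twistEnd_mul,
      zpow_apply_stretchCoeff hσ, add_zero]
    by_cases h : (l : ℤ) ∣ m - k
    · refine AddMonoidHom.ext fun x => ?_
      obtain ⟨i, hi⟩ := h
      have : (σ ^ (k : ℤ) : RingAut R) = σ ^ m := by
        rw [eq_add_of_sub_eq hi, zpow_add, zpow_mul, zpow_natCast (σ : RingAut R) l, hσl, one_zpow,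
          one_mul]
      change _ * (σ ^ (k : ℤ) : RingAut R) x = _ * (σ ^ m : RingAut R) x
      rw [this]
    · rw [stretchCoeff, if_neg h, mul_zero, twistEnd_zero, twistEnd_zero]

lemma isTwisted_polyExpand_mul_centerExpand
    (hσ : ∀ c, σ (algebraMap C R c) = algebraMap C R c) (hl : 0 < l)
    (hσl : (σ ^ l : RingAut R) = 1)
    (p : TwistedPoly R σ) (y : LaurentSeries C) :
    IsTwisted σ (polyExpand σ p * centerExpand σ hl y) :=
  fun m => ⟨_, coeff_polyExpand_mul_centerExpand hσ hl hσl p y m⟩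

/-- The polynomial with coefficients `φ(p_k)`, where `k` runs over a residue class modulo `l`. -/
noncomputable def residuePart (φ : R →ₗ[C] C) (l c : ℕ) (p : TwistedPoly R σ) : Polynomial C :=
  p.sum fun k a => if k % l = c then Polynomial.monomial (k / l) (φ ((Twist.of σ).symm a)) else 0

lemma coeff_residuePart (φ : R →ₗ[C] C) (l : ℕ) (p : TwistedPoly R σ) (k : ℕ) :
    (residuePart φ l (k % l) p).coeff (k / l) = φ ((Twist.of σ).symm (p.coeff k)) := by
  rw [residuePart, SkewPolynomial.sum_def, Polynomial.finsetSum_coeff, Finset.sum_eq_single k]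
  · rw [if_pos rfl, Polynomial.coeff_monomial, if_pos rfl]
  · intro i _ hi
    split_ifs with h
    · rw [Polynomial.coeff_monomial, if_neg fun h' => hi ?_]
      rw [← Nat.div_add_mod i l, ← Nat.div_add_mod k l, h, h']
    · exact Polynomial.coeff_zero _
  · intro h
    rw [SkewPolynomial.notMem_support_iff.mp h]
    simp

lemma algebraMap_monomial (n : ℕ) (c : C) : algebraMap (RatFunc C) (LaurentSeries C)
    (algebraMap _ _ (Polynomial.monomial n c)) = HahnSeries.single (n : ℤ) c := by
  rw [← IsScalarTower.algebraMap_apply, Polynomial.algebraMap_hahnSeries_apply,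
    ← Polynomial.C_mul_X_pow_eq_monomial]
  simp

/-- Only the exponents `k ≡ c` modulo `l` of `p` reach degree `c + l * m`; by `C`-linearity, `φ`
passes through the coefficients of `y`. This turns identities between skew series into identities in
`C((T))`. -/
lemma coeff_residuePart_mul (φ : R →ₗ[C] C) {l c : ℕ} (hc : c < l) (p : TwistedPoly R σ)
    (y : LaurentSeries C) (m : ℤ) :
    (algebraMap (RatFunc C) (LaurentSeries C) (algebraMap _ _ (residuePart φ l c p)) * y).coeff m =
      φ (mulCoeff l p y (c + l * m)) := by
  have hl' : (l : ℤ) ≠ 0 := by omega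
  rw [residuePart, mulCoeff, SkewPolynomial.sum_def, SkewPolynomial.sum_def, map_sum, map_sum,
    map_sum, Finset.sum_mul, HahnSeries.coeff_sum]
  refine Finset.sum_congr rfl fun k _ => ?_
  have hdvd : (l : ℤ) ∣ c + l * m - k ↔ k % l = c := by
    rw [add_sub_right_comm, dvd_add_left (dvd_mul_right _ _), ← Nat.modEq_iff_dvd, Nat.ModEq,
      Nat.mod_eq_of_lt hc]
  by_cases h : k % l = c
  · rw [if_pos h, stretchCoeff, if_pos (hdvd.mpr h), algebraMap_monomial,
      HahnSeries.coeff_single_mul, ← Algebra.commutes, ← Algebra.smul_def, map_smul, smul_eq_mul,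
      mul_comm]
    congr 2
    refine (Int.ediv_eq_of_eq_mul_right hl' ?_).symm
    have h1 : (l : ℤ) * (k / l : ℕ) + c = k := by
      rw [← h]
      exact_mod_cast Nat.div_add_mod k l
    rw [mul_sub, ← h1]
    ring
  · rw [if_neg h, stretchCoeff, if_neg (mt hdvd.mp h)]
    simp

lemma expand_const (hl : 0 < l) (c : C) : expand σ (TwistedFrac.const σ (algebraMap C R c)) =
    centerExpand σ hl (algebraMap (RatFunc C) (LaurentSeries C) (RatFunc.C c)) := by
  rw [← RatFunc.algebraMap_C, ← Polynomial.monomial_zero_left, algebraMap_monomial,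
    centerExpand_single]
  exact (expand_num σ _).trans (polyExpand_monomial σ 0 _)

lemma expand_t_pow (hl : 0 < l) (hσl : (σ ^ l : RingAut R) = 1) :
    expand σ (TwistedFrac.t σ ^ l) =
      centerExpand σ hl (algebraMap (RatFunc C) (LaurentSeries C) RatFunc.X) := by
  rw [RatFunc.coe_X, centerExpand_single, map_pow, TwistedFrac.t, expand_num]
  have h1 := polyExpand_monomial σ 1 1
  rw [map_one] at h1
  rw [SkewPolynomial.X, h1, HahnSeries.single_pow, Nat.cast_one, twistEnd_one_pow, map_one,
    nsmul_eq_mul]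
  congr 1
  refine AddMonoidHom.ext fun x => ?_
  change 1 * (σ ^ (l : ℤ) : RingAut R) x = 1 * x
  rw [zpow_natCast, hσl, RingAut.one_apply]

lemma mem_center_of_forall_num {z : TwistedFrac R σ}
    (hz : ∀ n x, z * TwistedFrac.num σ (SkewPolynomial.monomial n (Twist.of σ x)) =
      TwistedFrac.num σ (SkewPolynomial.monomial n (Twist.of σ x)) * z) :
    z ∈ Subring.center (TwistedFrac R σ) := by
  have hp : ∀ p, z * TwistedFrac.num σ p = TwistedFrac.num σ p * z := fun p => by
    induction p using SkewPolynomial.induction with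
    | h0 => simp
    | ha k r q _ _ ih =>
      rw [map_add, mul_add, add_mul, ih, ← (Twist.of σ).apply_symm_apply r, hz]
  refine Subring.mem_center_iff.mpr fun x => ?_
  obtain ⟨s, hs, p, hsp⟩ := exists_num_mul_eq_num σ x
  refine mul_left_cancel₀ (num_ne_zero σ hs) ?_
  rw [← mul_assoc, hsp, ← hp, ← hsp, ← mul_assoc, hp, mul_assoc]

/-- The central homomorphism `C(T) → R(t, σ)`, `T ↦ t ^ l`. -/
lemma exists_central_ringHom (hσ : ∀ c, σ (algebraMap C R c) = algebraMap C R c) (hl : 0 < l)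
    (hσl : (σ ^ l : RingAut R) = 1) : ∃ f : RatFunc C →+* TwistedFrac R σ,
      (∀ z x, f z * x = x * f z) ∧
      (∀ c, f (RatFunc.C c) = TwistedFrac.const σ (algebraMap C R c)) ∧
      f RatFunc.X = TwistedFrac.t σ ^ l := by
  have hσn : ∀ (n : ℕ) c, (σ ^ n : RingAut R) (algebraMap C R c) = algebraMap C R c :=
    fun n c => by rw [← zpow_natCast, zpow_apply_algebraMap hσ]
  have hc : ∀ c, TwistedFrac.const σ (algebraMap C R c) ∈ Subring.center (TwistedFrac R σ) :=
    fun c => mem_center_of_forall_num fun n x => by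
      change TwistedFrac.num σ (SkewPolynomial.monomial 0 (Twist.of σ (algebraMap C R c))) * _ =
        _ * TwistedFrac.num σ (SkewPolynomial.monomial 0 (Twist.of σ (algebraMap C R c)))
      rw [← map_mul, ← map_mul, TwistedFrac.monomial_mul, TwistedFrac.monomial_mul, hσn, zero_add,
        add_zero, pow_zero, RingAut.one_apply, Algebra.commutes]
  have ht : TwistedFrac.t σ ^ l ∈ Subring.center (TwistedFrac R σ) :=
    mem_center_of_forall_num fun n x => by
      rw [TwistedFrac.t, ← map_pow, SkewPolynomial.X_pow_eq_monomial, ← map_one (Twist.of σ),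
        ← map_mul, ← map_mul, TwistedFrac.monomial_mul, TwistedFrac.monomial_mul, hσl, map_one,
        mul_one, one_mul, RingAut.one_apply, add_comm]
  let φ : Polynomial C →+* Subring.center (TwistedFrac R σ) :=
    Polynomial.eval₂RingHom (((TwistedFrac.const σ).comp (algebraMap C R)).codRestrict _ hc)
      ⟨_, ht⟩
  have hφC : ∀ c, (φ (Polynomial.C c) : TwistedFrac R σ) =
      TwistedFrac.const σ (algebraMap C R c) := fun c => by simp [φ]
  have hφX : (φ Polynomial.X : TwistedFrac R σ) = TwistedFrac.t σ ^ l := by simp [φ]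
  have hφ : (expand σ).comp ((Subring.center (TwistedFrac R σ)).subtype.comp φ) =
      (centerExpand σ hl).comp
        ((algebraMap (RatFunc C) (LaurentSeries C)).comp (algebraMap _ _)) := by
    refine Polynomial.ringHom_ext (fun c => ?_) ?_
    · change expand σ (φ (Polynomial.C c)) = _
      rw [hφC, expand_const hl]
      simp
    · change expand σ (φ Polynomial.X) = _
      rw [hφX, expand_t_pow (C := C) hl hσl]
      simp
  have : Nontrivial (LaurentSeries (AddMonoid.End R)) :=
    ⟨polyExpand σ 1, 0, (map_ne_zero_iff _ (polyExpand_injective σ)).mpr one_ne_zero⟩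
  -- Extending `φ` to fractions requires `t ^ l` to be transcendental over `C`. This is read off
  -- after expansion, where `φ` becomes the embedding `C[T] ⊆ C((T))` followed by the injective
  -- `centerExpand`.
  have hinj : Function.Injective φ := by
    have h1 : Function.Injective ((centerExpand (R := R) σ hl).comp
        ((algebraMap (RatFunc C) (LaurentSeries C)).comp (algebraMap (Polynomial C) _))) :=
      (RingHom.injective (centerExpand (R := R) (C := C) σ hl)).comp
        ((algebraMap (RatFunc C) (LaurentSeries C)).injective.comp
          (RatFunc.algebraMap_injective C))
    rw [← hφ] at h1
    exact Function.Injective.of_comp (f := fun z : Subring.center (TwistedFrac R σ) =>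
      expand σ z) h1
  have hmem : nonZeroDivisors (Polynomial C) ≤ (nonZeroDivisors _).comap φ :=
    nonZeroDivisors_le_comap_nonZeroDivisors_of_injective φ hinj
  let f := RatFunc.liftRingHom φ hmem
  have hf : ∀ p, f (algebraMap _ _ p) = φ p := fun p => RatFunc.liftRingHom_algebraMap φ hmem p
  refine ⟨(Subring.center (TwistedFrac R σ)).subtype.comp f,
    fun z x => (Subring.mem_center_iff.mp (f z).2 x).symm, fun c => ?_, ?_⟩
  · rw [← hφC, ← hf, RatFunc.algebraMap_C]
    rfl
  · rw [← hφX, ← hf, RatFunc.algebraMap_X]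
    rfl

variable [Algebra (RatFunc C) (TwistedFrac R σ)]

lemma expand_algebraMap (hl : 0 < l) (hσl : (σ ^ l : RingAut R) = 1)
    (hC : ∀ c, algebraMap (RatFunc C) (TwistedFrac R σ) (RatFunc.C c) =
      TwistedFrac.const σ (algebraMap C R c))
    (hX : algebraMap (RatFunc C) (TwistedFrac R σ) RatFunc.X = TwistedFrac.t σ ^ l)
    (z : RatFunc C) : expand σ (algebraMap _ _ z) =
      centerExpand σ hl (algebraMap (RatFunc C) (LaurentSeries C) z) := by
  have : (expand σ).comp (algebraMap (RatFunc C) (TwistedFrac R σ)) =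
      (centerExpand σ hl).comp (algebraMap (RatFunc C) (LaurentSeries C)) :=
    ratFunc_ringHom_ext (W := LaurentSeries (AddMonoid.End R))
      (fun c => by rw [RingHom.comp_apply, RingHom.comp_apply, hC, expand_const hl])
      (by rw [RingHom.comp_apply, RingHom.comp_apply, hX, expand_t_pow (C := C) hl hσl])
  exact congrArg (fun φ => φ z) this

/-- `R(t, σ) ⊗ C((T))` has no zero divisors, where `T = t ^ l` is central. -/
theorem noZeroDivisors_twistedFrac_tensorProduct
    (hσ : ∀ c, σ (algebraMap C R c) = algebraMap C R c)
    (hl : 0 < l) (hσl : (σ ^ l : RingAut R) = 1)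
    (hC : ∀ c, algebraMap (RatFunc C) (TwistedFrac R σ) (RatFunc.C c) =
      TwistedFrac.const σ (algebraMap C R c))
    (hX : algebraMap (RatFunc C) (TwistedFrac R σ) RatFunc.X = TwistedFrac.t σ ^ l) :
    NoZeroDivisors (TwistedFrac R σ ⊗[RatFunc C] LaurentSeries C) := by
  let Θ : TwistedFrac R σ ⊗[RatFunc C] LaurentSeries C →+ LaurentSeries (AddMonoid.End R) :=
    TensorProduct.liftAddHom
      ((AddMonoidHom.mul.compl₂ (centerExpand (R := R) σ hl).toAddMonoidHom).comp
        (expand σ).toAddMonoidHom) fun z r y => by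
        change expand σ (z • r) * centerExpand σ hl y = expand σ r * centerExpand σ hl (z • y)
        rw [Algebra.smul_def, Algebra.smul_def, map_mul, map_mul,
          expand_algebraMap hl hσl hC hX, (centerExpand_commute_expand hσ hl _ r).eq, mul_assoc]
  have hΘ : ∀ r y, Θ (r ⊗ₜ y) = expand σ r * centerExpand σ hl y := fun r y => rfl
  have hmul : ∀ x y, Θ (x * y) = Θ x * Θ y := fun x y => by
    induction x with
    | zero => simp
    | add x x' hx hx' => rw [add_mul, map_add, map_add, hx, hx', add_mul]
    | tmul r u =>
      induction y with
      | zero => simp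
      | add y y' hy hy' => rw [mul_add, map_add, map_add, hy, hy', mul_add]
      | tmul s v =>
        rw [Algebra.TensorProduct.tmul_mul_tmul, hΘ, hΘ, hΘ, map_mul, map_mul, mul_assoc,
          mul_assoc, ← mul_assoc (expand σ s), ← (centerExpand_commute_expand hσ hl u s).eq,
          mul_assoc]
  let b := Module.Basis.ofVectorSpace (RatFunc C) (LaurentSeries C)
  let B := Algebra.TensorProduct.basis (TwistedFrac R σ) b
  -- After clearing the denominators of the coordinates of `x` along a `C(T)`-basis of `C((T))`, the
  -- image is a twisted series, hence invertible once it is nonzero.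
  have key : ∀ x : TwistedFrac R σ ⊗[RatFunc C] LaurentSeries C, x ≠ 0 →
      ∃ s : TwistedPoly R σ, s ≠ 0 ∧ IsUnit (Θ ((TwistedFrac.num σ s ⊗ₜ 1) * x)) := by
    intro x hx
    obtain ⟨s, hs, hsp⟩ := exists_common_denominator σ (B.repr x).support (B.repr x)
    choose! p hp using hsp
    have hΘx : Θ ((TwistedFrac.num σ s ⊗ₜ 1) * x) =
        ∑ i ∈ (B.repr x).support, polyExpand σ (p i) * centerExpand σ hl (b i) := by
      conv_lhs => rw [← B.linearCombination_repr x, Finsupp.linearCombination_apply, Finsupp.sum,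
        Finset.mul_sum, map_sum]
      refine Finset.sum_congr rfl fun i hi => ?_
      rw [Algebra.TensorProduct.basis_apply, TensorProduct.smul_tmul', smul_eq_mul, mul_one,
        Algebra.TensorProduct.tmul_mul_tmul, hp i hi, one_mul, hΘ, expand_num]
    refine ⟨s, hs, IsTwisted.isUnit (σ := σ) ?_ fun h0 => ?_⟩
    · rw [hΘx]
      exact Finset.sum_induction _ (IsTwisted σ) (fun _ _ => IsTwisted.add) IsTwisted.zero
        fun i _ => isTwisted_polyExpand_mul_centerExpand hσ hl hσl _ _
    -- Evaluation of the endomorphisms at `1` recovers the coefficients in `R`.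
    · have hsum : ∀ m, ∑ i ∈ (B.repr x).support, mulCoeff l (p i) (b i) m = 0 := fun m => by
        have h1 := congrArg (fun f => f.coeff m (1 : R)) (hΘx.symm.trans h0)
        simp only [HahnSeries.coeff_sum, coeff_polyExpand_mul_centerExpand hσ hl hσl] at h1
        rw [HahnSeries.coeff_zero] at h1
        have h2 := (AddMonoidHom.finsetSum_apply _ _ (1 : R)).symm.trans h1
        refine Eq.trans (Finset.sum_congr rfl fun i _ => ?_) h2
        exact (by rw [map_one, mul_one] : mulCoeff l (p i) (b i) m =
          mulCoeff l (p i) (b i) m * (σ ^ m : RingAut R) 1)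
      obtain ⟨i, hi⟩ := Finsupp.support_nonempty_iff.mpr
        ((map_ne_zero_iff _ B.repr.injective).mpr hx)
      have hpi : p i ≠ 0 := fun h => by
        have h1 := hp i hi
        rw [h, map_zero] at h1
        exact mul_ne_zero (num_ne_zero σ hs) (Finsupp.mem_support_iff.mp hi) h1
      obtain ⟨k, hk⟩ : ∃ k, (p i).coeff k ≠ 0 := by
        by_contra! h
        exact hpi (SkewPolynomial.ext h)
      -- A functional that detects a nonzero coefficient of `p i`, in degree `k`. On the residue
      -- class of `k` modulo `l` it yields a relation over `C[T]` between basis vectors, whose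
      -- coefficient at `i` is nonzero: a contradiction.
      obtain ⟨φ, hφ⟩ : ∃ φ : R →ₗ[C] C, φ ((Twist.of σ).symm ((p i).coeff k)) ≠ 0 := by
        by_contra! h
        exact hk ((map_eq_zero_iff _ (Twist.of σ).symm.injective).mp
          ((Module.forall_dual_apply_eq_zero_iff C _).mp h))
      have hlin : ∑ i ∈ (B.repr x).support,
          (algebraMap _ (RatFunc C) (residuePart φ l (k % l) (p i))) • b i = 0 := by
        ext m
        rw [HahnSeries.coeff_sum, HahnSeries.coeff_zero]
        simp only [Algebra.smul_def, coeff_residuePart_mul φ (Nat.mod_lt k hl)]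
        rw [← map_sum, hsum, map_zero]
      have h0 := linearIndependent_iff'.mp b.linearIndependent _ _ hlin i hi
      rw [map_eq_zero_iff _ (RatFunc.algebraMap_injective C)] at h0
      exact hφ (by rw [← coeff_residuePart, h0, Polynomial.coeff_zero])
  refine ⟨fun {x y} hxy => ?_⟩
  by_contra! hne
  obtain ⟨s, hs, hsu⟩ := key y hne.2
  have hs' := num_ne_zero σ hs
  have hinv : ((TwistedFrac.num σ s)⁻¹ ⊗ₜ[RatFunc C] (1 : LaurentSeries C)) *
      (TwistedFrac.num σ s ⊗ₜ 1) = 1 := by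
    rw [Algebra.TensorProduct.tmul_mul_tmul, inv_mul_cancel₀ hs', one_mul]
    rfl
  -- Inserting `s⁻¹ s` between `x` and `y` keeps their product zero, while making the images of both
  -- factors invertible, the left one after multiplication by `u`.
  obtain ⟨u, -, huu⟩ := key (x * ((TwistedFrac.num σ s)⁻¹ ⊗ₜ 1)) fun h => hne.1 <| by
    rw [← mul_one x, ← hinv, ← mul_assoc, h, zero_mul]
  have h0 : Θ ((TwistedFrac.num σ u ⊗ₜ 1) * (x * ((TwistedFrac.num σ s)⁻¹ ⊗ₜ 1))) *
      Θ ((TwistedFrac.num σ s ⊗ₜ 1) * y) = 0 := by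
    rw [← hmul, mul_assoc, mul_assoc x, ← mul_assoc _ _ y, hinv, one_mul, hxy, mul_zero, map_zero]
  have : Nontrivial (LaurentSeries (AddMonoid.End R)) := by
    refine ⟨polyExpand σ 1, 0, (map_ne_zero_iff _ (polyExpand_injective σ)).mpr one_ne_zero⟩
  exact (huu.mul hsu).ne_zero h0

end Center

/-! ### Passage to directed unions and subfields; from `SIGP` to `IGP` -/

section DirectedUnion

open scoped TensorProduct

/-- Over a field, tensoring preserves injections, so the `D n ⊗ N` embed in `H ⊗ N`; any two
elements come from a common stage. -/
lemma noZeroDivisors_tensorProduct_of_directed {Z H N : Type u} [Field Z] [Ring H]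
    [Algebra Z H] [Ring N] [Algebra Z N] {D : ℕ → Type u} [∀ n, Ring (D n)]
    [∀ n, Algebra Z (D n)] (φ : ∀ n, D n →ₐ[Z] H) (hinj : ∀ n, Function.Injective (φ n))
    (hmono : ∀ i j, i ≤ j → ∀ x, ∃ y, φ j y = φ i x) (hsurj : ∀ z, ∃ n x, φ n x = z)
    (hD : ∀ n, NoZeroDivisors (D n ⊗[Z] N)) : NoZeroDivisors (H ⊗[Z] N) := by
  let Φ : ∀ n, D n ⊗[Z] N →ₐ[Z] H ⊗[Z] N := fun n =>
    Algebra.TensorProduct.map (φ n) (AlgHom.id Z N)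
  have hΦ : ∀ n, Function.Injective (Φ n) := fun n =>
    Module.Flat.rTensor_preserves_injective_linearMap (M := N) (φ n).toLinearMap (hinj n)
  have hΦmono : ∀ i j, i ≤ j → ∀ x, ∃ y, Φ j y = Φ i x := fun i j hij x => by
    induction x with
    | zero => exact ⟨0, by rw [map_zero, map_zero]⟩
    | tmul r y =>
      obtain ⟨s, hs⟩ := hmono i j hij r
      exact ⟨s ⊗ₜ y, by simp [Φ, hs]⟩
    | add x x' hx hx' =>
      obtain ⟨y, hy⟩ := hx
      obtain ⟨y', hy'⟩ := hx'
      exact ⟨y + y', by rw [map_add, map_add, hy, hy']⟩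
  have hΦsurj : ∀ z, ∃ n x, Φ n x = z := fun z => by
    induction z with
    | zero => exact ⟨0, 0, map_zero _⟩
    | tmul r y =>
      obtain ⟨n, s, rfl⟩ := hsurj r
      exact ⟨n, s ⊗ₜ y, by simp [Φ]⟩
    | add z z' hz hz' =>
      obtain ⟨n, x, rfl⟩ := hz
      obtain ⟨n', x', rfl⟩ := hz'
      obtain ⟨y, hy⟩ := hΦmono n (max n n') (le_max_left _ _) x
      obtain ⟨y', hy'⟩ := hΦmono n' (max n n') (le_max_right _ _) x'
      exact ⟨_, y + y', by rw [map_add, hy, hy']⟩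
  refine ⟨fun {z z'} hzz => ?_⟩
  obtain ⟨n, x, rfl⟩ := hΦsurj z
  obtain ⟨n', x', rfl⟩ := hΦsurj z'
  obtain ⟨y, hy⟩ := hΦmono n (max n n') (le_max_left _ _) x
  obtain ⟨y', hy'⟩ := hΦmono n' (max n n') (le_max_right _ _) x'
  rw [← hy, ← hy'] at hzz ⊢
  rw [← map_mul, map_eq_zero_iff _ (hΦ _)] at hzz
  have := hD (max n n')
  rcases mul_eq_zero.mp hzz with h | h
  · exact Or.inl (by rw [h, map_zero])
  · exact Or.inr (by rw [h, map_zero])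

lemma noZeroDivisors_tensorProduct_of_le {Z H N : Type u} [Field Z] [Ring H] [Algebra Z H]
    [Field N] [Algebra Z N] [NoZeroDivisors (H ⊗[Z] N)] (L : IntermediateField Z N) :
    NoZeroDivisors (H ⊗[Z] L) := by
  let Φ : H ⊗[Z] L →ₐ[Z] H ⊗[Z] N := Algebra.TensorProduct.map (AlgHom.id Z H) L.val
  have hΦ : Function.Injective Φ :=
    Module.Flat.lTensor_preserves_injective_linearMap (M := H) L.val.toLinearMap
      Subtype.val_injective
  exact hΦ.noZeroDivisors Φ (map_zero _) (map_mul _)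

/-- `SIGP` does not ask for `L` to be finite over `F(t)`. If the group is finite, its Krull topology
is discrete, so the trivial subgroup is open and its fixed field `L` is finite over `Z`. -/
lemma finiteDimensional_of_finite_galois {Z L : Type*} [Field Z] [Field L] [Algebra Z L]
    [IsGalois Z L] [Finite (L ≃ₐ[Z] L)] : FiniteDimensional Z L := by
  have h : IsOpen ((⊤ : IntermediateField Z L).fixingSubgroup : Set (L ≃ₐ[Z] L)) :=
    isOpen_discrete _
  have := (InfiniteGalois.isOpen_iff_finite (⊤ : IntermediateField Z L)).mp h
  exact Module.Finite.equiv (IntermediateField.topEquiv (F := Z) (E := L)).toLinearEquiv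

/-- If `H ⊗ F((t))` has no zero divisors, where `H` is an extension of `F(t)` with `F(t)` central,
then `SIGP` for `F` implies `IGP` for `H`. -/
theorem igp_of_noZeroDivisors {F H : Type u} [Field F] [DivisionRing H] [Algebra (RatFunc F) H]
    [NoZeroDivisors (H ⊗[RatFunc F] LaurentSeries F)] (hF : SIGP F) : IGP H := by
  intro G _ _
  obtain ⟨L, hL, ⟨e⟩⟩ := hF G
  have : Finite (L ≃ₐ[RatFunc F] L) := Finite.of_equiv G e.symm.toEquiv
  have : FiniteDimensional (RatFunc F) L := finiteDimensional_of_finite_galois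
  have : NoZeroDivisors (H ⊗[RatFunc F] L) := noZeroDivisors_tensorProduct_of_le L
  obtain ⟨K, hK, f, hg, ho, ⟨e'⟩⟩ :=
    exists_outer_galois_of_noZeroDivisors (Z := RatFunc F) (H := H) (L := L)
  exact ⟨K, hK, f, hg, ho, ⟨e'.trans e⟩⟩

end DirectedUnion

/-! ### The direct limit -/

section Limit

variable {h : Type u} [DivisionRing h] {E : ℕ → Subfield h} {τ : ∀ n, E n ≃+* E n} {l : ℕ → ℕ}

namespace TransitionsDefined

/-- The canonical homomorphism from the `n`-th field to the limit. -/
noncomputable def limitOf (H : TransitionsDefined E τ l) (n : ℕ) :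
    TwistedFrac (E n) (τ n) →+* H.Limit :=
  DirectLimit.Ring.of (fun n => TwistedFrac (E n) (τ n)) (fun i j hij => H.trans i j hij) n

lemma limitOf_trans (H : TransitionsDefined E τ l) {i j : ℕ} (hij : i ≤ j)
    (x : TwistedFrac (E i) (τ i)) : H.limitOf j (H.trans i j hij x) = H.limitOf i x :=
  DirectLimit.Ring.of_f (f := fun i j hij => H.trans i j hij) hij x

lemma exists_limitOf_eq (H : TransitionsDefined E τ l) (z : H.Limit) :
    ∃ n x, H.limitOf n x = z :=
  DirectLimit.induction (fun i j hij => H.trans i j hij)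
    (C := fun z => ∃ n x, H.limitOf n x = z) (fun n x => ⟨n, x, rfl⟩) z

lemma trans_const (H : TransitionsDefined E τ l) {i j : ℕ} (hij : i ≤ j) (x : E i) :
    H.trans i j hij (TwistedFrac.const (τ i) x) =
      TwistedFrac.const (τ j) (Subfield.inclusion (H.le hij) x) :=
  H.trans_monomial i j hij 0 x

lemma trans_t_pow (H : TransitionsDefined E τ l) {i j : ℕ} (hij : i ≤ j) (n : ℕ) :
    H.trans i j hij (TwistedFrac.t (τ i) ^ n) = TwistedFrac.t (τ j) ^ (l j / l i * n) := by
  have := H.trans_monomial i j hij n 1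
  rw [map_one (Subfield.inclusion _), map_one (Twist.of _), map_one (Twist.of _),
    SkewPolynomial.monomial_one_right_eq_X_pow, SkewPolynomial.monomial_one_right_eq_X_pow,
    map_pow, map_pow, map_pow] at this
  rw [map_pow]
  exact this

/-- If `F` is central in all the fields of the tower, and `τ n ^ l n = 1` for all `n`, then `F(T)`
is central in the limit, where `T` is the class of the `t ^ l n`, and `SIGP` descends. -/
theorem igp_limit (H : TransitionsDefined E τ l) {F : Type u} [Field F]
    (ι : ∀ n, F →+* E n) (hcomm : ∀ n c x, ι n c * x = x * ι n c)
    (hι : ∀ n c, (ι n c : h) = ι 0 c) (hτ : ∀ n c, τ n (ι n c) = ι n c)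
    (hτl : ∀ n, (τ n ^ l n : RingAut (E n)) = 1) (hF : SIGP F) : IGP H.Limit := by
  let : ∀ n, Algebra F (E n) := fun n => (ι n).toAlgebra' (hcomm n)
  choose f hf hfC hfX using fun n =>
    exists_central_ringHom (σ := τ n) (C := F) (hτ n) (H.pos n) (hτl n)
  let : ∀ n, Algebra (RatFunc F) (TwistedFrac (E n) (τ n)) := fun n => (f n).toAlgebra' (hf n)
  -- The embeddings of `F(T)` at the various stages agree in the limit, since `t ^ l 0` goes to `t ^
  -- (l n / l 0 * l 0) = t ^ l n`.
  have hcompat : ∀ n z, H.limitOf n (f n z) = H.limitOf 0 (f 0 z) := fun n z => by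
    have h1 : f n = (H.trans 0 n n.zero_le).comp (f 0) := by
      refine ratFunc_ringHom_ext (fun c => ?_) ?_
      · rw [RingHom.comp_apply, hfC, hfC, trans_const]
        exact congrArg _ (Subtype.ext (hι n c))
      · rw [RingHom.comp_apply, hfX, hfX, trans_t_pow,
          Nat.div_mul_cancel (H.dvd' n.zero_le)]
    rw [h1, RingHom.comp_apply, limitOf_trans]
  -- Centrality is tested against an `x` from stage `n`, where the image of `F(T)` can be computed
  -- by `f n`.
  let : Algebra (RatFunc F) H.Limit := ((H.limitOf 0).comp (f 0)).toAlgebra' fun z x => by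
    obtain ⟨n, x, rfl⟩ := H.exists_limitOf_eq x
    rw [RingHom.comp_apply, ← hcompat n, ← map_mul, ← map_mul, hf]
  let φ : ∀ n, TwistedFrac (E n) (τ n) →ₐ[RatFunc F] H.Limit := fun n =>
    { H.limitOf n with commutes' := hcompat n }
  have := noZeroDivisors_tensorProduct_of_directed (N := LaurentSeries F) φ
    (fun n => (H.limitOf n).injective)
    (fun i j hij x => ⟨H.trans i j hij x, H.limitOf_trans hij x⟩) H.exists_limitOf_eq
    fun n => noZeroDivisors_twistedFrac_tensorProduct (hτ n) (H.pos n) (hτl n) (hfC n) (hfX n)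
  exact igp_of_noZeroDivisors hF

end TransitionsDefined

end Limit

end TwistedTower

theorem theorem6 {h : Type u} [DivisionRing h] (k : Subfield h) (E : ℕ → Subfield h) (d : ℕ → ℕ)
    (σ : ∀ n, E n ≃+* E n) (hT : TwistedTower.IsCyclicOuterTower k E d σ)
    (hd : ∀ n, Nat.Coprime (d (n + 1) / d n) (d n))
    (F : Subfield (Subring.center k)) :
    (∃ l : ℕ → ℕ, TwistedTower.Admissible d (fun _ => 1) l) ∧
    ∀ l : ℕ → ℕ, TwistedTower.Admissible d (fun _ => 1) l →
      ∃ H : TwistedTower.TransitionsDefined E σ l,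
        TwistedTower.SIGP F → TwistedTower.IGP H.Limit := by
  refine ⟨hT.exists_admissible hd, fun l hl => ⟨hT.transitionsDefined hl, fun hF => ?_⟩⟩
  refine TwistedTower.TransitionsDefined.igp_limit _
    (fun n => (Subfield.inclusion (hT.base n)).comp
      ((Subring.center k).subtype.comp F.subtype))
    (fun n c x => hT.commute n c x) (fun n c => rfl) (fun n c => hT.mem_gal n _) (fun n => ?_) hF
  -- This is the last divisibility of `Admissible` for `a = 1`; it makes `t ^ l n` central.
  obtain ⟨m, hm⟩ : d n ∣ l n := by simpa using hl.dvd_mul n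
  rw [hm, pow_mul, hT.pow_eq_one, one_pow]
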